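/- Let $\mathsf H=\mathbb C^N$, let $\mathcal L(\rho)=-i[H,\rho]+\tfrac12\sum_\ell\kappa_\ell\,(2F_\ell\rho F_\ell^\dagger-F_\ell^\dagger F_\ell\rho-\rho F_\ell^\dagger F_\ell)$ be a Lindbladian with Hermitian $H$, finitely many jump operators $F_\ell$ and rates $\kappa_\ell>0$, and suppose that it has no residual unitary evolution, i.e. $P_\infty=\lim_{t\to\infty}e^{t\mathcal L}$ exists. Let $\mathrm{As}(\mathsf H)=P_\infty\,\mathrm{Op}(\mathsf H)$, and let $P$ be the orthogonal projection with $P\rho_\infty P=\rho_\infty$ for all $\rho_\infty\in\mathrm{As}(\mathsf H)$ and $\mathrm{tr}\,P=\max_{\rho_\infty\in\mathrm{As}(\mathsf H)}\mathrm{rank}\,\rho_\infty$. Put $Q=I-P$, $A_{ul}=\mathcal R_{ul}(A)=PAP$, $\mathcal R_{lr}(A)=QAQ$, $\mathcal R_3=\mathrm{id}-\mathcal R_{lr}$ (the projection on the three non-decaying corners) and $P_\Psi=P_\infty\mathcal R_{ul}$. Let $V=V^\dagger$, let $f_\ell$ be arbitrary operators, and let $$\mathcal O(\rho)=-i[V,\rho]+\sum_\ell\kappa_\ell\Big(F_\ell\rho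 f_\ell^\dagger+f_\ell\rho F_\ell^\dagger-\tfrac12\{f_\ell^\dagger F_\ell+F_\ell^\dagger f_\ell,\rho\}\Big)$$ be the first-order term in $g$ of the change of $\mathcal L$ under $H\to H+gV$, $F_\ell\to F_\ell+gf_\ell$. Then: 1. (No leak, clean leak.) For all $\rho_\infty\in\mathrm{As}(\mathsf H)$, $\mathcal R_{lr}\mathcal O(\rho_\infty)=0$ and $P_\infty\mathcal OP_\infty(\rho_\infty)=P_\Psi\mathcal OP_\Psi(\rho_\infty)$. As superoperators, $P_\infty\mathcal OP_\infty=P_\Psi\mathcal OP_\infty$ and $P_\infty\mathcal OP_\infty\mathcal R_{ul}=P_\Psi\mathcal OP_\Psi$. 2. (Hamiltonian form.) There is a Hermitian $G=PGP$ with $P_\infty\mathcal OP_\infty(\rho)=-i[G,P_\infty(\rho)]$ for all $\rho$. Moreover, let $\mathrm{As}(\mathsf H)=\bigoplus_k\mathrm{Op}(\mathsf H_{dfs}^{(k)})\otimes\varrho_{ax}^{(k)}$ be any decomposition into noiseless-subsystem blocks, where the $\mathsf H_{dfs}^{(k)}\otimes\mathsf H_{ax}^{(k)}$ are identified with mutually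 orthogonal subspaces of $\mathsf H$ and $\varrho_{ax}^{(k)}$ is a full-rank density matrix on $\mathsf H_{ax}^{(k)}$. Then the operators $$X^{(k)}=\mathrm{tr}_{ax}^{(k)}\Big\{\varrho_{ax}^{(k)}\Big(V_{ul}+\tfrac i2\sum_\ell\kappa_\ell\big((F_\ell)_{ul}^\dagger (f_\ell)_{ul}-(f_\ell)_{ul}^\dagger (F_\ell)_{ul}\big)\Big)\Big\}$$ (the operator in parentheses being compressed to block $k$ before the partial trace) are Hermitian, $P_\infty\mathcal OP_\infty(A\otimes\varrho_{ax}^{(k)})=-i[X^{(k)},A]\otimes\varrho_{ax}^{(k)}$ for all $A\in\mathrm{Op}(\mathsf H_{dfs}^{(k)})$, and for every $\rho\in\mathrm{Op}(\mathsf H)$ $$P_\Psi\mathcal OP_\Psi(\rho)=\bigoplus_k\,-i\big[X^{(k)},\mathrm{tr}_{ax}^{(k)}\{\rho^{(k)}\}\big]\otimes\varrho_{ax}^{(k)},$$ where $\rho^{(k)}$ is the compression of $\rho$ to $\mathsf H_{dfs}^{(k)}\otimes\mathsf H_{ax}^{(k)}$. 3. (Leakage.) $\mathcal L$ maps the range of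 $\mathcal R_3$ into itself. The pseudoinverse $\mathcal L^{-1}=-\int_0^\infty e^{\tau\mathcal L}(\mathrm{id}-P_\infty)\,d\tau$ exists and is the (index one) Drazin inverse of $\mathcal L$, with $\mathcal L\mathcal L^{-1}=\mathrm{id}-P_\infty$. The Drazin inverse $\mathcal L_3^{-1}$ of $\mathcal L_3=\mathcal R_3\mathcal L\mathcal R_3$ also exists and has index one, and $\mathcal L^{-1}\mathcal O(\rho_\infty)=\mathcal L^{-1}\mathcal R_3\mathcal O(\rho_\infty)=\mathcal L_3^{-1}\mathcal O(\rho_\infty)$ for all $\rho_\infty\in\mathrm{As}(\mathsf H)$. -/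

import Mathlib

open Matrix Filter
open scoped Kronecker Topology ComplexOrder

namespace LindbladResponse

/-- Superoperators: linear maps on the space of operators `Op(H)`, `H = ℂⁿ`. Multiplication is
composition. -/
abbrev SuperOp (n : Type*) [Fintype n] [DecidableEq n] : Type _ :=
  Module.End ℂ (Matrix n n ℂ)

section Basic

variable {n ι : Type*} [Fintype n] [DecidableEq n] [Fintype ι]

/-- The superoperator `ρ ↦ A ρ B`. -/
def sandwich (A B : Matrix n n ℂ) : SuperOp n :=
  LinearMap.mulLeft ℂ A * LinearMap.mulRight ℂ B

@[simp] theorem sandwich_apply (A B ρ : Matrix n n ℂ) : sandwich A B ρ = A * ρ * B := by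
  simp [sandwich, mul_assoc]

/-- The superoperator `ρ ↦ -i [V, ρ]`. -/
noncomputable def hamSuper (V : Matrix n n ℂ) : SuperOp n :=
  -Complex.I • (LinearMap.mulLeft ℂ V - LinearMap.mulRight ℂ V)

@[simp] theorem hamSuper_apply (V ρ : Matrix n n ℂ) :
    hamSuper V ρ = -Complex.I • (V * ρ - ρ * V) := by
  simp [hamSuper]

/-- The anticommutator superoperator `ρ ↦ {K, ρ}`. -/
def antiSuper (K : Matrix n n ℂ) : SuperOp n :=
  LinearMap.mulLeft ℂ K + LinearMap.mulRight ℂ K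

@[simp] theorem antiSuper_apply (K ρ : Matrix n n ℂ) : antiSuper K ρ = K * ρ + ρ * K := by
  simp [antiSuper]

/-- The Lindbladian
`ρ ↦ -i[H, ρ] + (1/2) ∑ₗ κₗ (2 Fₗ ρ Fₗ† - Fₗ† Fₗ ρ - ρ Fₗ† Fₗ)`. -/
noncomputable def lindbladian (H : Matrix n n ℂ) (F : ι → Matrix n n ℂ) (κ : ι → ℝ) :
    SuperOp n :=
  hamSuper H + (1 / 2 : ℂ) • ∑ l, (κ l : ℂ) •
    ((2 : ℂ) • sandwich (F l) (F l)ᴴ - antiSuper ((F l)ᴴ * F l))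

/-- The perturbation superoperator `O = 𝒱 + 𝒴`, where `𝒱 ρ = -i[V, ρ]` and
`𝒴 ρ = ∑ₗ κₗ (Fₗ ρ fₗ† + fₗ ρ Fₗ† - (1/2) {fₗ† Fₗ + Fₗ† fₗ, ρ})`. -/
noncomputable def perturbation (F : ι → Matrix n n ℂ) (κ : ι → ℝ) (V : Matrix n n ℂ)
    (f : ι → Matrix n n ℂ) : SuperOp n :=
  hamSuper V + ∑ l, (κ l : ℂ) •
    (sandwich (F l) (f l)ᴴ + sandwich (f l) (F l)ᴴ -
      (1 / 2 : ℂ) • antiSuper ((f l)ᴴ * F l + (F l)ᴴ * f l))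

/-- `perturbation F κ V f` is exactly the coefficient of `g` in the Lindbladian with
`H → H + g V` and `Fₗ → Fₗ + g fₗ`. -/
theorem lindbladian_perturbed (H : Matrix n n ℂ) (F : ι → Matrix n n ℂ) (κ : ι → ℝ)
    (V : Matrix n n ℂ) (f : ι → Matrix n n ℂ) (g : ℝ) :
    lindbladian (H + (g : ℂ) • V) (fun l => F l + (g : ℂ) • f l) κ =
      lindbladian H F κ + (g : ℂ) • perturbation F κ V f
        + ((g : ℂ) ^ 2) • lindbladian 0 f κ := by
  refine LinearMap.ext fun ρ => ?_
  simp only [lindbladian, perturbation, LinearMap.add_apply, LinearMap.smul_apply,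
    LinearMap.sum_apply, LinearMap.sub_apply, sandwich_apply, hamSuper_apply, antiSuper_apply,
    Finset.smul_sum]
  have key : ∀ l, (1 / 2 : ℂ) • (κ l : ℂ) • ((2 : ℂ) • ((F l + (g : ℂ) • f l) * ρ *
        (F l + (g : ℂ) • f l)ᴴ) - ((F l + (g : ℂ) • f l)ᴴ * (F l + (g : ℂ) • f l) * ρ +
          ρ * ((F l + (g : ℂ) • f l)ᴴ * (F l + (g : ℂ) • f l)))) =
      (1 / 2 : ℂ) • (κ l : ℂ) • ((2 : ℂ) • (F l * ρ * (F l)ᴴ) -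
          ((F l)ᴴ * F l * ρ + ρ * ((F l)ᴴ * F l))) +
      (g : ℂ) • (κ l : ℂ) • (F l * ρ * (f l)ᴴ + f l * ρ * (F l)ᴴ -
          (1 / 2 : ℂ) • (((f l)ᴴ * F l + (F l)ᴴ * f l) * ρ +
            ρ * ((f l)ᴴ * F l + (F l)ᴴ * f l))) +
      ((g : ℂ) ^ 2) • (1 / 2 : ℂ) • (κ l : ℂ) • ((2 : ℂ) • (f l * ρ * (f l)ᴴ) -
          ((f l)ᴴ * f l * ρ + ρ * ((f l)ᴴ * f l))) := by
    intro l
    simp only [conjTranspose_add, conjTranspose_smul, Complex.star_def, Complex.conj_ofReal,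
      add_mul, mul_add, smul_mul_assoc, mul_smul_comm]
    module
  rw [Finset.sum_congr rfl fun l _ => key l, Finset.sum_add_distrib, Finset.sum_add_distrib]
  simp only [add_mul, mul_add, smul_mul_assoc, mul_smul_comm, zero_mul, mul_zero, smul_add,
    Finset.smul_sum]
  module

/-- The evolution superoperator `e^{tL}`: the exponential of `t L`, written as an
`N² × N²` matrix. -/
noncomputable def evolution (L : SuperOp n) (t : ℝ) : SuperOp n :=
  Matrix.toLinAlgEquiv (Matrix.stdBasis ℂ n n)
    (NormedSpace.exp ((t : ℂ) • LinearMap.toMatrixAlgEquiv (Matrix.stdBasis ℂ n n) L))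

/-- `Linv X = -∫₀^∞ e^{τL} (X - P∞ X) dτ` for every operator `X`, where the (entrywise)
improper integral converges: `Linv` is the pseudoinverse `L⁻¹` of the Lindbladian. -/
def IsLeakageInverse (L Pinf Linv : SuperOp n) : Prop :=
  ∀ (X : Matrix n n ℂ) (i j : n), Tendsto
    (fun T : ℝ => -∫ τ in (0 : ℝ)..T, evolution L τ (X - Pinf X) i j) atTop (𝓝 (Linv X i j))

/-- `P∞` is the asymptotic projection of a Lindbladian without residual unitary evolution
(`H∞ = 0`): every initial operator `ρ` evolves to the stationary asymptotic operator
`lim_{t → ∞} e^{tL} ρ = P∞ ρ`. -/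
def IsAsymptoticProjection (L Pinf : SuperOp n) : Prop :=
  ∀ ρ : Matrix n n ℂ, Tendsto (fun t : ℝ => evolution L t ρ) atTop (𝓝 (Pinf ρ))

/-- The asymptotic subspace `As(H) = P∞ Op(H)`. -/
def asymptoticSubspace (Pinf : SuperOp n) : Submodule ℂ (Matrix n n ℂ) :=
  LinearMap.range Pinf

/-- `P` is the orthogonal projection onto the non-decaying subspace: `P ρ∞ P = ρ∞` for all
`ρ∞ ∈ As(H)`, and `tr P` is the maximal rank of an element of `As(H)`. -/
structure IsNonDecayingProjection (Pinf : SuperOp n) (P : Matrix n n ℂ) : Prop where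
  isHermitian : P.IsHermitian
  idempotent : P * P = P
  fixes : ∀ ρ ∈ asymptoticSubspace Pinf, P * ρ * P = ρ
  trace_eq_max_rank : ∃ r : ℕ,
    IsGreatest (Matrix.rank '' (asymptoticSubspace Pinf : Set (Matrix n n ℂ))) r ∧
      P.trace = (r : ℂ)

/-- The upper-left corner projection `ρ ↦ P ρ P`. -/
def cornerUL (P : Matrix n n ℂ) : SuperOp n := sandwich P P

/-- The lower-right corner projection `ρ ↦ Q ρ Q`, `Q = 1 - P`. -/
def cornerLR (P : Matrix n n ℂ) : SuperOp n := sandwich (1 - P) (1 - P)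

/-- The projection `1 - R_lr` on the three non-decaying corners (upper left, upper right,
lower left). -/
def cornerThree (P : Matrix n n ℂ) : SuperOp n := 1 - cornerLR P

/-- The minimal projection `P_Ψ = P∞ R_ul`. -/
def minimalProjection (Pinf : SuperOp n) (P : Matrix n n ℂ) : SuperOp n := Pinf * cornerUL P

/-- The operator `V_ul + (i/2) ∑ₗ κₗ (F_ul† f_ul - f_ul† F_ul)`, where `A_ul = P A P`. -/
noncomputable def perturbationHamiltonian (P : Matrix n n ℂ) (F : ι → Matrix n n ℂ)
    (κ : ι → ℝ) (V : Matrix n n ℂ) (f : ι → Matrix n n ℂ) : Matrix n n ℂ :=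
  cornerUL P V + (Complex.I / 2) • ∑ l, (κ l : ℂ) •
    ((cornerUL P (F l))ᴴ * cornerUL P (f l) - (cornerUL P (f l))ᴴ * cornerUL P (F l))

/-- `D` is the (index one) Drazin pseudoinverse of `A`. -/
structure IsDrazinInverse (A D : SuperOp n) : Prop where
  comm : A * D = D * A
  inner : A * D * A = A
  outer : D * A * D = D

/-- There is at most one Drazin pseudoinverse. -/
theorem IsDrazinInverse.unique {A D D' : SuperOp n} (h : IsDrazinInverse A D)
    (h' : IsDrazinInverse A D') : D = D' := by
  have e : D * A = A * D' := by
    calc D * A = D * (A * D' * A) := by rw [h'.inner]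
      _ = D * A * (D' * A) := by simp only [mul_assoc]
      _ = A * D * (A * D') := by rw [h.comm, h'.comm]
      _ = A * D * A * D' := by simp only [mul_assoc]
      _ = A * D' := by rw [h.inner]
  calc D = D * A * D := h.outer.symm
    _ = D * (A * D) := by rw [mul_assoc]
    _ = D * (A * D') := by rw [h.comm, e]
    _ = D * A * D' := by rw [mul_assoc]
    _ = A * D' * D' := by rw [e]
    _ = D' * A * D' := by rw [h'.comm]
    _ = D' := h'.outer

end Basic

section NoiselessSubsystems

variable {n d a : Type*} [Fintype n] [DecidableEq n] [Fintype d] [DecidableEq d] [Fintype a]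
  [DecidableEq a]

/-- The partial trace over the auxiliary factor of `H_dfs ⊗ H_ax`. -/
def traceAx (M : Matrix (d × a) (d × a) ℂ) : Matrix d d ℂ :=
  Matrix.of fun i j => ∑ k, M (i, k) (j, k)

/-- The effective Hamiltonian `tr_ax {ϱ_ax X}` of the operator `X` on the block
`H_dfs ⊗ H_ax` of `H`, embedded by the isometry `W`. -/
def effectiveHamiltonian (W : Matrix n (d × a) ℂ) (ϱ : Matrix a a ℂ) (X : Matrix n n ℂ) :
    Matrix d d ℂ :=
  traceAx (((1 : Matrix d d ℂ) ⊗ₖ ϱ) * (Wᴴ * X * W))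

end NoiselessSubsystems

/-- A decomposition `As(H) = ⨁_k Op(H_dfs^k) ⊗ ϱ_ax^k` of the asymptotic subspace into
noiseless-subsystem blocks. The spaces `H_dfs^k ⊗ H_ax^k` are embedded isometrically and with
mutually orthogonal ranges in `H` by the `W k`, and `ϱ k` is a density matrix of full rank on
`H_ax^k`. -/
structure IsNSDecomposition {n K : Type*} [Fintype n] [DecidableEq n] [Fintype K]
    {d a : K → Type*} [∀ k, Fintype (d k)] [∀ k, DecidableEq (d k)]
    [∀ k, Fintype (a k)] [∀ k, DecidableEq (a k)]
    (As : Submodule ℂ (Matrix n n ℂ))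
    (W : ∀ k, Matrix n (d k × a k) ℂ) (ϱ : ∀ k, Matrix (a k) (a k) ℂ) : Prop where
  isometry : ∀ k, (W k)ᴴ * W k = 1
  orthogonal : ∀ k l, k ≠ l → (W k)ᴴ * W l = 0
  posDef : ∀ k, (ϱ k).PosDef
  trace_one : ∀ k, (ϱ k).trace = 1
  mem_iff : ∀ X : Matrix n n ℂ, X ∈ As ↔
    ∃ B : ∀ k, Matrix (d k) (d k) ℂ, X = ∑ k, W k * (B k ⊗ₖ ϱ k) * (W k)ᴴ

end LindbladResponse

open LindbladResponse

/-!
The proof is algebraic, apart from two facts about the semigroup: `e^{tL}` preserves positivity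
(`posSemidef_evolution_lindbladian`), and `P∞` projects onto `ker L` along `range L`
(`IsAsymptoticProjection.mem_asymptoticSubspace_iff`, `IsAsymptoticProjection.eq_apply_add`).

Write `L ρ = K ρ + ρ K† + ∑ₗ κₗ Fₗ ρ Fₗ†` with `K = -iH - (1/2) ∑ₗ κₗ Fₗ† Fₗ`. By positivity the
stationary state `P∞ 1` dominates all of `As(H)`, so it is faithful on the block of `P`. Compressing
`L (P∞ 1) = 0` to the corners then gives `Q Fₗ P = 0` and `Q K P = 0`
(`IsNonDecayingProjection.isInvariantBlock`). Hence `O` does not leak into the lower right corner,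
and the three other corners form an invariant subspace of `L`.

Asymptotic states are separated by conserved quantities, that is, by the operators `P (P∞† Y) P`.
The dissipation identity, paired with the faithful state, shows that these commute with `K`, `Fₗ`
and their adjoints on the block (`commutesOnBlock_of_conserved`). This has three consequences.

* Their pairing with coherences between the block and its complement is zero and stays zero in
  time, so coherences do not survive:
  `P∞ X = P∞ (P X P)` if `Q X Q = 0` (`IsNonDecayingProjection.apply_eq_apply_compression`).
* They may be moved past `Fₗ` and `Fₗ†` under the trace, so they do not distinguish `O` from the
  commutator with the perturbation Hamiltonian `A`
  (`CommutesOnBlock.trace_mul_perturbation`).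
* They map `As(H)` to itself by multiplication. Hence `P∞ (A ρ) = G ρ` and `P∞ (ρ A) = ρ G` on
  `As(H)`, where `G = P (P∞† A) P` (`IsNonDecayingProjection.apply_hamSuper`). This is the
  Hamiltonian form, obtained without the structure theorem for `As(H)`.

If a decomposition into blocks `Op(H_dfs) ⊗ ϱ_ax` is given, multiplying the full-rank state
`⨁ 1 ⊗ ϱ_ax` shows that a conserved quantity equals `B ⊗ 1` on each block; for `G` the pairing with
`As(H)` identifies `B` with `tr_ax {ϱ_ax A}` (`IsNSDecomposition.traceDual_mul`).

The pseudoinverse is `L⁻¹ = (L - P∞)⁻¹ + P∞`. It preserves every subspace that contains `As(H)` and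
is invariant under `L`, since `L - P∞` is injective there; on the three non-decaying corners it
therefore restricts to the Drazin inverse of the restriction of `L`.
-/

namespace LindbladResponse

/-! ### The semigroup `e^{tL}` -/

section Evolution

variable {n : Type*} [Fintype n] [DecidableEq n]

/-- The matrix entry `(e^{tL} X)ᵢⱼ` as a linear function of the matrix `e^{tL}`. -/
noncomputable def entryFunctional (X : Matrix n n ℂ) (i j : n) :
    Matrix (n × n) (n × n) ℂ →ₗ[ℂ] ℂ where
  toFun M := Matrix.toLinAlgEquiv (Matrix.stdBasis ℂ n n) M X i j
  map_add' M N := by simp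
  map_smul' c M := by simp

theorem entryFunctional_apply (X : Matrix n n ℂ) (i j : n) (M : Matrix (n × n) (n × n) ℂ) :
    entryFunctional X i j M = Matrix.toLinAlgEquiv (Matrix.stdBasis ℂ n n) M X i j := rfl

theorem continuous_entryFunctional (X : Matrix n n ℂ) (i j : n) :
    Continuous (entryFunctional X i j) :=
  LinearMap.continuous_of_finiteDimensional _

theorem evolution_zero (L : SuperOp n) : evolution L 0 = 1 := by
  simp [evolution, NormedSpace.exp_zero]

theorem evolution_add (L : SuperOp n) (s t : ℝ) :
    evolution L (s + t) = evolution L s * evolution L t := by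
  rw [evolution, Complex.ofReal_add, add_smul,
    Matrix.exp_add_of_commute _ _ ((Commute.refl _).smul_left _ |>.smul_right _), map_mul]
  rfl

section Norm

open scoped Matrix.Norms.Operator

theorem hasDerivAt_evolution_apply (L : SuperOp n) (X : Matrix n n ℂ) (i j : n) (t : ℝ) :
    HasDerivAt (fun t : ℝ => evolution L t X i j) (evolution L t (L X) i j) t := by
  set M := LinearMap.toMatrixAlgEquiv (Matrix.stdBasis ℂ n n) L with hM
  have h1 : HasDerivAt (fun u : ℂ => NormedSpace.exp (u • M))
      (NormedSpace.exp ((t : ℂ) • M) * M) (t : ℂ) := hasDerivAt_exp_smul_const M (t : ℂ)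
  have h2 := ((LinearMap.toContinuousLinearMap (entryFunctional X i j)).hasFDerivAt.comp_hasDerivAt
    _ h1).comp_ofReal
  have h3 : entryFunctional X i j (NormedSpace.exp ((t : ℂ) • M) * M) =
      evolution L t (L X) i j := by
    rw [entryFunctional_apply, map_mul, hM, Matrix.toLinAlgEquiv_toMatrixAlgEquiv]
    rfl
  rw [← h3]
  exact h2

theorem hasSum_evolution_apply (L : SuperOp n) (t : ℝ) (X : Matrix n n ℂ) (i j : n) :
    HasSum (fun k : ℕ => ((k.factorial : ℂ)⁻¹ • (t : ℂ) ^ k • (L ^ k) X) i j)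
      (evolution L t X i j) := by
  set M := LinearMap.toMatrixAlgEquiv (Matrix.stdBasis ℂ n n) L with hM
  have h1 : HasSum (fun k : ℕ => ((k.factorial : ℂ)⁻¹ • ((t : ℂ) • M) ^ k))
      (NormedSpace.exp ((t : ℂ) • M)) := NormedSpace.exp_series_hasSum_exp' _
  have h2 : HasSum
      (entryFunctional X i j ∘ fun k : ℕ => ((k.factorial : ℂ)⁻¹ • ((t : ℂ) • M) ^ k))
      (evolution L t X i j) :=
    h1.map (entryFunctional X i j) (continuous_entryFunctional X i j)
  convert h2 using 1
  funext k
  rw [Function.comp_apply, entryFunctional_apply, smul_pow, map_smul, map_smul, map_pow, hM,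
    Matrix.toLinAlgEquiv_toMatrixAlgEquiv]
  rfl

theorem continuous_evolution_apply (L₀ L₁ : SuperOp n) (t : ℝ) (X : Matrix n n ℂ) (i j : n) :
    Continuous (fun ε : ℝ => evolution (L₀ + (ε : ℂ) • L₁) t X i j) := by
  have : Continuous (fun ε : ℝ => NormedSpace.exp ((t : ℂ) •
      (LinearMap.toMatrixAlgEquiv (Matrix.stdBasis ℂ n n) L₀ +
        (ε : ℂ) • LinearMap.toMatrixAlgEquiv (Matrix.stdBasis ℂ n n) L₁))) := by
    refine NormedSpace.exp_continuous.comp ?_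
    fun_prop
  have h2 := (continuous_entryFunctional X i j).comp this
  convert h2 using 2
  simp [entryFunctional_apply, evolution]

theorem evolution_add_smul_one (Φ : SuperOp n) (c t : ℝ) (X : Matrix n n ℂ) :
    evolution (Φ + (c : ℂ) • 1) t X = (Real.exp (t * c) : ℂ) • evolution Φ t X := by
  have hc : NormedSpace.exp ((t : ℂ) • (c : ℂ) • (1 : Matrix (n × n) (n × n) ℂ)) =
      (Real.exp (t * c) : ℂ) • 1 := by
    have h := NormedSpace.algebraMap_exp_comm (𝕂 := ℂ) (𝔸 := Matrix (n × n) (n × n) ℂ)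
      ((t * c : ℝ) : ℂ)
    rw [smul_smul, ← Complex.ofReal_mul, ← Algebra.algebraMap_eq_smul_one]
    refine h.symm.trans ?_
    rw [Algebra.algebraMap_eq_smul_one, ← Complex.exp_eq_exp_ℂ, Complex.ofReal_exp]
  rw [evolution, map_add, map_smul, map_one, smul_add, Matrix.exp_add_of_commute, hc]
  · simp [evolution]
  · exact ((Commute.one_right _).smul_right _).smul_right _

end Norm

omit [DecidableEq n] in
/-- Entrywise limits of positive semidefinite matrices are positive semidefinite. -/
theorem posSemidef_of_tendsto {α : Type*} {l : Filter α} [l.NeBot] {A : α → Matrix n n ℂ}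
    {B : Matrix n n ℂ} (hA : ∀ᶠ x in l, (A x).PosSemidef)
    (h : ∀ i j, Tendsto (fun x => A x i j) l (𝓝 (B i j))) : B.PosSemidef := by
  refine PosSemidef.of_dotProduct_mulVec_nonneg ?_ fun v => ?_
  · ext i j
    refine tendsto_nhds_unique ((continuous_star.tendsto _).comp (h j i)) ((h i j).congr' ?_)
    filter_upwards [hA] with x hx
    exact (hx.1.apply i j).symm
  · refine ge_of_tendsto (f := fun x => star v ⬝ᵥ (A x *ᵥ v)) (x := l) ?_ ?_
    · simp only [dotProduct, mulVec]
      exact tendsto_finsetSum _ fun i _ => (tendsto_finsetSum _ fun j _ =>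
        (h i j).mul_const _).const_mul _
    · filter_upwards [hA] with x hx
      exact hx.dotProduct_mulVec_nonneg v

end Evolution

/-! ### Positivity of the semigroup -/

section Positivity

variable {n ι : Type*} [Fintype n] [DecidableEq n] [Fintype ι]

theorem posSemidef_evolution_of_positive {Φ : SuperOp n}
    (hΦ : ∀ X, X.PosSemidef → (Φ X).PosSemidef) {t : ℝ} (ht : 0 ≤ t) {X : Matrix n n ℂ}
    (hX : X.PosSemidef) : (evolution Φ t X).PosSemidef := by
  have hpow : ∀ k : ℕ, ((Φ ^ k) X).PosSemidef := by
    intro k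
    induction k with
    | zero => simpa using hX
    | succ k ih => rw [pow_succ']; exact hΦ _ ih
  refine posSemidef_of_tendsto (l := atTop)
    (A := fun s : Finset ℕ => ∑ k ∈ s, ((k.factorial : ℂ)⁻¹ • (t : ℂ) ^ k • (Φ ^ k) X))
    (Eventually.of_forall fun s => ?_) fun i j => ?_
  · refine posSemidef_sum s fun k _ => ((hpow k).smul ?_).smul ?_
    · exact_mod_cast pow_nonneg ht k
    · exact inv_nonneg.2 (Nat.cast_nonneg _)
  · simpa only [Matrix.sum_apply, HasSum, SummationFilter.unconditional_filter] using
      hasSum_evolution_apply Φ t X i j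

/-- The non-Hermitian generator `K = -iH - (1/2) ∑ₗ κₗ Fₗ† Fₗ` of the evolution without jumps. -/
noncomputable def noJumpGenerator (H : Matrix n n ℂ) (F : ι → Matrix n n ℂ) (κ : ι → ℝ) :
    Matrix n n ℂ :=
  -Complex.I • H - (1 / 2 : ℂ) • ∑ l, (κ l : ℂ) • ((F l)ᴴ * F l)

variable {H : Matrix n n ℂ} {F : ι → Matrix n n ℂ} {κ : ι → ℝ}

omit [DecidableEq n] in
theorem noJumpGenerator_conjTranspose (hH : H.IsHermitian) :
    (noJumpGenerator H F κ)ᴴ =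
      Complex.I • H - (1 / 2 : ℂ) • ∑ l, (κ l : ℂ) • ((F l)ᴴ * F l) := by
  simp [noJumpGenerator, conjTranspose_sub, conjTranspose_smul, conjTranspose_sum, hH.eq]

omit [DecidableEq n] in
theorem noJumpGenerator_add_conjTranspose (hH : H.IsHermitian) :
    noJumpGenerator H F κ + (noJumpGenerator H F κ)ᴴ = -∑ l, (κ l : ℂ) • ((F l)ᴴ * F l) := by
  rw [noJumpGenerator_conjTranspose hH, noJumpGenerator]
  module

theorem lindbladian_apply (hH : H.IsHermitian) (ρ : Matrix n n ℂ) :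
    lindbladian H F κ ρ = noJumpGenerator H F κ * ρ + ρ * (noJumpGenerator H F κ)ᴴ +
      ∑ l, (κ l : ℂ) • (F l * ρ * (F l)ᴴ) := by
  rw [noJumpGenerator_conjTranspose hH]
  simp only [lindbladian, noJumpGenerator, LinearMap.add_apply, LinearMap.smul_apply,
    LinearMap.sum_apply, LinearMap.sub_apply, sandwich_apply, hamSuper_apply, antiSuper_apply,
    sub_mul, mul_sub, smul_mul_assoc, mul_smul_comm, Finset.sum_mul, Finset.mul_sum, smul_sub,
    smul_add, Finset.sum_sub_distrib, Finset.sum_add_distrib, mul_assoc]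
  have : ∀ l, (κ l : ℂ) • (2 : ℂ) • (F l * (ρ * (F l)ᴴ)) =
      (2 : ℂ) • (κ l : ℂ) • (F l * (ρ * (F l)ᴴ)) := fun l => smul_comm _ _ _
  simp only [this, ← Finset.smul_sum]
  module

/-- The semigroup of a Lindbladian preserves positivity. The generator `L` is the limit, as
`ε → 0`, of `L + ε K · K† = ε⁻¹ ((1 + ε K) · (1 + ε K)† + ε ∑ₗ κₗ Fₗ · Fₗ†) - ε⁻¹`, which up to
a multiple of the identity is a positive map. -/
theorem posSemidef_evolution_lindbladian (hH : H.IsHermitian) (hκ : ∀ l, 0 < κ l) {t : ℝ}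
    (ht : 0 ≤ t) {X : Matrix n n ℂ} (hX : X.PosSemidef) :
    (evolution (lindbladian H F κ) t X).PosSemidef := by
  set K := noJumpGenerator H F κ with hK
  have hc : ∀ i j, Tendsto (fun ε : ℝ =>
      evolution (lindbladian H F κ + (ε : ℂ) • sandwich K Kᴴ) t X i j) (𝓝[>] 0)
      (𝓝 (evolution (lindbladian H F κ) t X i j)) := by
    intro i j
    have := (continuous_evolution_apply (lindbladian H F κ) (sandwich K Kᴴ) t X i j).tendsto 0
    simp only [Complex.ofReal_zero, zero_smul, add_zero] at this
    exact this.mono_left nhdsWithin_le_nhds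
  refine posSemidef_of_tendsto (l := 𝓝[>] (0 : ℝ)) ?_ hc
  filter_upwards [self_mem_nhdsWithin] with ε hε
  have hε' : (0 : ℝ) < ε := hε
  have hεc : (ε : ℂ) ≠ 0 := by exact_mod_cast hε'.ne'
  set Φ : SuperOp n := ((ε⁻¹ : ℝ) : ℂ) • sandwich (1 + (ε : ℂ) • K) (1 + (ε : ℂ) • K)ᴴ +
    ∑ l, (κ l : ℂ) • sandwich (F l) (F l)ᴴ with hΦ
  have hdec : lindbladian H F κ + (ε : ℂ) • sandwich K Kᴴ =
      Φ + ((-ε⁻¹ : ℝ) : ℂ) • (1 : SuperOp n) := by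
    refine LinearMap.ext fun ρ => ?_
    simp only [hΦ, LinearMap.add_apply, LinearMap.smul_apply, LinearMap.sum_apply,
      sandwich_apply, lindbladian_apply hH, ← hK, conjTranspose_add, conjTranspose_smul,
      conjTranspose_one, Complex.star_def, Complex.conj_ofReal, add_mul, mul_add, smul_mul_assoc,
      mul_smul_comm, one_mul, mul_one, smul_add, smul_smul, Complex.ofReal_neg,
      Complex.ofReal_inv, Module.End.one_apply]
    rw [show (ε : ℂ)⁻¹ * (ε : ℂ) = 1 by field_simp,
      show (ε : ℂ)⁻¹ * ((ε : ℂ) * (ε : ℂ)) = ε by field_simp]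
    module
  rw [hdec, evolution_add_smul_one]
  refine PosSemidef.smul (posSemidef_evolution_of_positive ?_ ht hX) ?_
  · intro Y hY
    simp only [hΦ, LinearMap.add_apply, LinearMap.smul_apply, LinearMap.sum_apply,
      sandwich_apply]
    refine PosSemidef.add ((hY.mul_mul_conjTranspose_same _).smul ?_)
      (posSemidef_sum _ fun l _ => (hY.mul_mul_conjTranspose_same _).smul ?_)
    · exact_mod_cast (inv_pos.2 hε').le
    · exact_mod_cast (hκ l).le
  · exact_mod_cast (Real.exp_pos _).le

end Positivity

/-! ### The asymptotic projection and the pseudoinverse of `L` -/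

section Asymptotics

variable {n : Type*} [Fintype n] [DecidableEq n] {L Pinf : SuperOp n}

namespace IsAsymptoticProjection

theorem tendsto_entry (h : IsAsymptoticProjection L Pinf) (X : Matrix n n ℂ) (i j : n) :
    Tendsto (fun t : ℝ => evolution L t X i j) atTop (𝓝 (Pinf X i j)) :=
  tendsto_pi_nhds.1 (tendsto_pi_nhds.1 (h X) i) j

theorem evolution_apply (h : IsAsymptoticProjection L Pinf) (X : Matrix n n ℂ) (s : ℝ) :
    Pinf (evolution L s X) = Pinf X := by
  refine tendsto_nhds_unique (h (evolution L s X)) ?_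
  refine ((h X).comp (tendsto_atTop_add_const_right atTop s tendsto_id)).congr fun t => ?_
  simp [evolution_add]

/-- `L P∞ = P∞ L`, because `L` commutes with `e^{tL}`. -/
theorem commute (h : IsAsymptoticProjection L Pinf) (X : Matrix n n ℂ) :
    L (Pinf X) = Pinf (L X) := by
  have hL : Continuous L := LinearMap.continuous_of_finiteDimensional L
  refine tendsto_nhds_unique ((hL.tendsto _).comp (h X)) ((h (L X)).congr fun t => ?_)
  simp only [Function.comp_apply, evolution]
  set M := LinearMap.toMatrixAlgEquiv (Matrix.stdBasis ℂ n n) L with hM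
  have hLM : L = Matrix.toLinAlgEquiv (Matrix.stdBasis ℂ n n) M := by
    rw [hM, Matrix.toLinAlgEquiv_toMatrixAlgEquiv]
  have hc : Commute (NormedSpace.exp ((t : ℂ) • M)) M :=
    ((Commute.refl M).smul_left _).exp_left
  have := congrArg (fun N => Matrix.toLinAlgEquiv (Matrix.stdBasis ℂ n n) N X) hc.eq
  simp only [map_mul, ← hLM] at this
  exact this

theorem apply_map (h : IsAsymptoticProjection L Pinf) (X : Matrix n n ℂ) : Pinf (L X) = 0 := by
  have hP : Continuous Pinf := LinearMap.continuous_of_finiteDimensional Pinf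
  ext i j
  let φ : Matrix n n ℂ →ₗ[ℂ] ℂ :=
    { toFun := fun Y => Pinf Y i j, map_add' := by simp, map_smul' := by simp }
  -- `s ↦ P∞ (e^{sL} X)` is constant, and its derivative at `0` is `P∞ (L X)`.
  have hd : HasDerivAt (fun s : ℝ => φ (evolution L s X)) (φ (L X)) 0 := by
    have hφ : ∀ Y : Matrix n n ℂ, φ Y = ∑ a, ∑ b, Y a b * φ (Matrix.single a b 1) := by
      intro Y
      conv_lhs => rw [Matrix.matrix_eq_sum_single Y]
      simp only [map_sum]
      refine Finset.sum_congr rfl fun a _ => Finset.sum_congr rfl fun b _ => ?_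
      rw [← smul_eq_mul, ← map_smul, Matrix.smul_single, smul_eq_mul, mul_one]
    have h0 := fun a b => hasDerivAt_evolution_apply L X a b 0
    simp only [evolution_zero, Module.End.one_apply] at h0
    rw [hφ (L X)]
    simp_rw [hφ (evolution L _ X)]
    exact HasDerivAt.fun_sum fun a _ => HasDerivAt.fun_sum fun b _ => (h0 a b).mul_const _
  have hc : (fun s : ℝ => φ (evolution L s X)) = fun _ => φ X :=
    funext fun s => congrFun (congrFun (h.evolution_apply X s) i) j
  rw [hc] at hd
  exact hd.unique (hasDerivAt_const _ _)

theorem map_apply (h : IsAsymptoticProjection L Pinf) (X : Matrix n n ℂ) : L (Pinf X) = 0 := by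
  rw [h.commute, h.apply_map]

theorem apply_eq_self (h : IsAsymptoticProjection L Pinf) {X : Matrix n n ℂ} (hX : L X = 0) :
    Pinf X = X := by
  ext i j
  have hd : ∀ t : ℝ, HasDerivAt (fun t : ℝ => evolution L t X i j) 0 t := fun t => by
    simpa [hX] using hasDerivAt_evolution_apply L X i j t
  have hc : ∀ t : ℝ, evolution L t X i j = X i j := fun t => by
    rw [is_const_of_deriv_eq_zero (fun t => (hd t).differentiableAt) (fun t => (hd t).deriv) t 0,
      evolution_zero, Module.End.one_apply]
  refine tendsto_nhds_unique (h.tendsto_entry X i j) ?_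
  simp only [hc]
  exact tendsto_const_nhds

theorem apply_apply (h : IsAsymptoticProjection L Pinf) (X : Matrix n n ℂ) :
    Pinf (Pinf X) = Pinf X :=
  h.apply_eq_self (h.map_apply X)

theorem mem_asymptoticSubspace_iff (h : IsAsymptoticProjection L Pinf) {X : Matrix n n ℂ} :
    X ∈ asymptoticSubspace Pinf ↔ L X = 0 := by
  refine ⟨?_, fun hX => ⟨X, h.apply_eq_self hX⟩⟩
  rintro ⟨Y, rfl⟩
  exact h.map_apply Y

theorem apply_of_mem (h : IsAsymptoticProjection L Pinf) {X : Matrix n n ℂ}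
    (hX : X ∈ asymptoticSubspace Pinf) : Pinf X = X :=
  h.apply_eq_self (h.mem_asymptoticSubspace_iff.1 hX)

theorem isUnit_sub (h : IsAsymptoticProjection L Pinf) : IsUnit (L - Pinf) := by
  rw [LinearMap.isUnit_iff_ker_eq_bot, LinearMap.ker_eq_bot']
  intro X hX
  rw [LinearMap.sub_apply, sub_eq_zero] at hX
  have h1 : Pinf X = 0 := by rw [← h.apply_apply, ← hX, h.apply_map]
  rw [← h.apply_eq_self (hX.trans h1), h1]

end IsAsymptoticProjection

/-- The pseudoinverse `(L - P∞)⁻¹ + P∞` of `L`: it inverts `L` on the range of `1 - P∞` and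
vanishes on the range of `P∞`. The inverse is a genuine one when `P∞` is the asymptotic projection
of `L`, by `IsAsymptoticProjection.isUnit_sub`. -/
noncomputable def drazinInverse (L Pinf : SuperOp n) : SuperOp n :=
  Ring.inverse (L - Pinf) + Pinf

namespace IsAsymptoticProjection

theorem map_mul_proj (h : IsAsymptoticProjection L Pinf) : L * Pinf = 0 :=
  LinearMap.ext h.map_apply

theorem proj_mul_map (h : IsAsymptoticProjection L Pinf) : Pinf * L = 0 :=
  LinearMap.ext h.apply_map

theorem proj_mul_proj (h : IsAsymptoticProjection L Pinf) : Pinf * Pinf = Pinf :=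
  LinearMap.ext h.apply_apply

theorem inverse_mul_proj (h : IsAsymptoticProjection L Pinf) :
    Ring.inverse (L - Pinf) * Pinf = -Pinf := by
  have e : (L - Pinf) * Pinf = -Pinf := by
    rw [sub_mul, h.map_mul_proj, h.proj_mul_proj, zero_sub]
  rw [← neg_eq_iff_eq_neg, ← mul_neg, ← e, ← mul_assoc, Ring.inverse_mul_cancel _ h.isUnit_sub,
    one_mul]

theorem proj_mul_inverse (h : IsAsymptoticProjection L Pinf) :
    Pinf * Ring.inverse (L - Pinf) = -Pinf := by
  have e : Pinf * (L - Pinf) = -Pinf := by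
    rw [mul_sub, h.proj_mul_map, h.proj_mul_proj, zero_sub]
  rw [← neg_eq_iff_eq_neg, ← neg_mul, ← e, mul_assoc, Ring.mul_inverse_cancel _ h.isUnit_sub,
    mul_one]

theorem map_mul_drazinInverse (h : IsAsymptoticProjection L Pinf) :
    L * drazinInverse L Pinf = 1 - Pinf := by
  have e := Ring.mul_inverse_cancel _ h.isUnit_sub
  rw [sub_mul, h.proj_mul_inverse, sub_neg_eq_add] at e
  rw [drazinInverse, mul_add, h.map_mul_proj, add_zero, ← e, add_sub_cancel_right]

theorem drazinInverse_mul_map (h : IsAsymptoticProjection L Pinf) :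
    drazinInverse L Pinf * L = 1 - Pinf := by
  have e := Ring.inverse_mul_cancel _ h.isUnit_sub
  rw [mul_sub, h.inverse_mul_proj, sub_neg_eq_add] at e
  rw [drazinInverse, add_mul, h.proj_mul_map, add_zero, ← e, add_sub_cancel_right]

theorem proj_mul_drazinInverse (h : IsAsymptoticProjection L Pinf) :
    Pinf * drazinInverse L Pinf = 0 := by
  rw [drazinInverse, mul_add, h.proj_mul_inverse, h.proj_mul_proj, neg_add_cancel]

theorem isDrazinInverse (h : IsAsymptoticProjection L Pinf) :
    IsDrazinInverse L (drazinInverse L Pinf) where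
  comm := by rw [h.map_mul_drazinInverse, h.drazinInverse_mul_map]
  inner := by rw [h.map_mul_drazinInverse, sub_mul, one_mul, h.proj_mul_map, sub_zero]
  outer := by
    rw [h.drazinInverse_mul_map, sub_mul, one_mul, h.proj_mul_drazinInverse, sub_zero]

/-- Since `X - P∞ X = L Y` with `Y = L⁻¹ X`, the integrand is the derivative of `e^{τL} Y`. -/
theorem isLeakageInverse (h : IsAsymptoticProjection L Pinf) :
    IsLeakageInverse L Pinf (drazinInverse L Pinf) := by
  intro X i j
  set Y := drazinInverse L Pinf X with hY
  have hLY : X - Pinf X = L Y := (LinearMap.congr_fun h.map_mul_drazinInverse X).symm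
  have hPY : Pinf Y = 0 := LinearMap.congr_fun h.proj_mul_drazinInverse X
  have hint : ∀ T : ℝ, ∫ τ in (0 : ℝ)..T, evolution L τ (X - Pinf X) i j =
      evolution L T Y i j - Y i j := by
    intro T
    have hcont : Continuous fun τ : ℝ => evolution L τ (L Y) i j :=
      continuous_iff_continuousAt.2 fun τ => (hasDerivAt_evolution_apply L (L Y) i j τ).continuousAt
    rw [hLY, intervalIntegral.integral_eq_sub_of_hasDerivAt
      (fun τ _ => hasDerivAt_evolution_apply L Y i j τ) (hcont.intervalIntegrable _ _),
      evolution_zero, Module.End.one_apply]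
  simp only [hint, neg_sub]
  have := (h.tendsto_entry Y i j).const_sub (Y i j)
  rwa [hPY, Matrix.zero_apply, sub_zero] at this

/-- A subspace, cut out by `N X = 0`, which is invariant under `L` and contains `As(H)` is also
invariant under the pseudoinverse: `L - P∞` is injective on it, hence bijective. -/
theorem drazinInverse_mem (h : IsAsymptoticProjection L Pinf) {N : SuperOp n}
    (hL : ∀ X, N X = 0 → N (L X) = 0) (hPinf : ∀ X, N (Pinf X) = 0) {X : Matrix n n ℂ}
    (hX : N X = 0) : N (drazinInverse L Pinf X) = 0 := by
  have hinj : Function.Injective (L - Pinf) :=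
    LinearMap.ker_eq_bot.1 (LinearMap.isUnit_iff_ker_eq_bot _ |>.1 h.isUnit_sub)
  have hle : (LinearMap.ker N).map (L - Pinf) ≤ LinearMap.ker N := by
    rintro _ ⟨Z, hZ, rfl⟩
    rw [SetLike.mem_coe, LinearMap.mem_ker] at hZ
    rw [LinearMap.mem_ker, LinearMap.sub_apply, map_sub, hL Z hZ, hPinf, sub_zero]
  have heq : (LinearMap.ker N).map (L - Pinf) = LinearMap.ker N :=
    Submodule.eq_of_le_of_finrank_eq hle
      (LinearEquiv.finrank_eq (Submodule.equivMapOfInjective _ hinj _)).symm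
  obtain ⟨Z, hZ, rfl⟩ : X ∈ (LinearMap.ker N).map (L - Pinf) := by
    rw [heq]; exact hX
  have hinv : Ring.inverse (L - Pinf) ((L - Pinf) Z) = Z :=
    LinearMap.congr_fun (Ring.inverse_mul_cancel _ h.isUnit_sub) Z
  rw [drazinInverse, LinearMap.add_apply, hinv, map_add, hPinf, add_zero]
  exact hZ

/-- The decomposition of `X` into its asymptotic part and a part in the range of `L`. -/
theorem eq_apply_add (h : IsAsymptoticProjection L Pinf) (X : Matrix n n ℂ) :
    X = Pinf X + L (drazinInverse L Pinf X) := by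
  have : L (drazinInverse L Pinf X) = X - Pinf X := LinearMap.congr_fun h.map_mul_drazinInverse X
  rw [this, add_sub_cancel]

theorem apply_conjTranspose (h : IsAsymptoticProjection L Pinf)
    (hL : ∀ X, L Xᴴ = (L X)ᴴ) (X : Matrix n n ℂ) : Pinf Xᴴ = (Pinf X)ᴴ := by
  have h1 : L (Pinf X)ᴴ = 0 := by rw [hL, h.map_apply, conjTranspose_zero]
  conv_lhs => rw [h.eq_apply_add X]
  rw [conjTranspose_add, map_add, ← hL, h.apply_map, add_zero, h.apply_eq_self h1]

end IsAsymptoticProjection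

end Asymptotics

/-! ### The non-decaying block -/

section Support

variable {n ι : Type*} [Fintype n] [DecidableEq n] [Fintype ι]

omit [DecidableEq n] in
theorem mul_eq_zero_of_posSemidef {ρ : Matrix n n ℂ} (hρ : ρ.PosSemidef) {A : Matrix n n ℂ}
    (h : A * ρ * Aᴴ = 0) : A * ρ = 0 := by
  classical
  obtain ⟨B, rfl⟩ : ∃ B : Matrix n n ℂ, ρ = Bᴴ * B := by
    open scoped MatrixOrder in
    exact CStarAlgebra.nonneg_iff_eq_star_mul_self.1 hρ.nonneg
  have h1 : (B * Aᴴ)ᴴ * (B * Aᴴ) = 0 := by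
    rw [conjTranspose_mul, conjTranspose_conjTranspose, ← h]
    simp only [mul_assoc]
  have h2 : B * Aᴴ = 0 := conjTranspose_mul_self_eq_zero.1 h1
  have h3 : A * Bᴴ = 0 := by
    rw [← conjTranspose_eq_zero, conjTranspose_mul, conjTranspose_conjTranspose, h2]
  rw [← mul_assoc, h3, zero_mul]

section Norm

open scoped MatrixOrder Matrix.Norms.L2Operator

theorem exists_posSemidef_smul_one_add {X : Matrix n n ℂ} (hX : X.IsHermitian) :
    ∃ c : ℝ, ((c : ℂ) • (1 : Matrix n n ℂ) + X).PosSemidef ∧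
      ((c : ℂ) • (1 : Matrix n n ℂ) - X).PosSemidef := by
  have hX' : IsSelfAdjoint X := hX
  refine ⟨‖X‖, ?_, ?_⟩
  · have := hX'.neg_algebraMap_norm_le_self
    rw [Matrix.le_iff, sub_neg_eq_add, Algebra.algebraMap_eq_smul_one, add_comm] at this
    simpa using this
  · have := hX'.le_algebraMap_norm_self
    rw [Matrix.le_iff, Algebra.algebraMap_eq_smul_one] at this
    simpa using this

end Norm

variable {H : Matrix n n ℂ} {F : ι → Matrix n n ℂ} {κ : ι → ℝ} {Pinf : SuperOp n}
  {P : Matrix n n ℂ}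

theorem IsAsymptoticProjection.posSemidef_apply
    (h : IsAsymptoticProjection (lindbladian H F κ) Pinf) (hH : H.IsHermitian)
    (hκ : ∀ l, 0 < κ l) {X : Matrix n n ℂ} (hX : X.PosSemidef) : (Pinf X).PosSemidef := by
  refine posSemidef_of_tendsto (l := atTop) ?_ (h.tendsto_entry X)
  filter_upwards [eventually_ge_atTop (0 : ℝ)] with t ht
  exact posSemidef_evolution_lindbladian hH hκ ht hX

/-- The stationary state `P∞ 1` dominates, up to a constant, every `P∞ X` with `X` Hermitian;
hence its kernel annihilates all of `As(H)`. -/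
theorem IsAsymptoticProjection.mul_apply_eq_zero
    (h : IsAsymptoticProjection (lindbladian H F κ) Pinf) (hH : H.IsHermitian)
    (hκ : ∀ l, 0 < κ l) {A : Matrix n n ℂ} (hA : A * Pinf 1 * Aᴴ = 0) (X : Matrix n n ℂ) :
    A * Pinf X = 0 := by
  have hA1 : A * Pinf 1 = 0 :=
    mul_eq_zero_of_posSemidef (h.posSemidef_apply hH hκ PosSemidef.one) hA
  have herm : ∀ Y : Matrix n n ℂ, Y.IsHermitian → A * Pinf Y = 0 := by
    intro Y hY
    obtain ⟨c, h1, h2⟩ := exists_posSemidef_smul_one_add hY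
    have p1 := h.posSemidef_apply hH hκ h1
    have p2 := (h.posSemidef_apply hH hκ h2).mul_mul_conjTranspose_same A
    have q1 := p1.mul_mul_conjTranspose_same A
    simp only [map_add, map_sub, map_smul, mul_add, mul_sub, mul_smul_comm, hA1, smul_zero,
      zero_add, zero_sub, neg_mul] at q1 p2
    have hz : A * Pinf Y * Aᴴ = 0 := by
      open scoped MatrixOrder in
      exact le_antisymm (neg_nonneg.1 (nonneg_iff_posSemidef.2 p2)) (nonneg_iff_posSemidef.2 q1)
    have := mul_eq_zero_of_posSemidef (A := A) p1 (by
      simp only [map_add, map_smul, mul_add, mul_smul_comm, hA1, smul_zero, zero_add, hz])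
    simpa only [map_add, map_smul, mul_add, mul_smul_comm, hA1, smul_zero, zero_add] using this
  have hX : X = (1 / 2 : ℂ) • (X + Xᴴ) - (Complex.I / 2) • (Complex.I • (X - Xᴴ)) := by
    rw [smul_smul, div_mul_eq_mul_div, Complex.I_mul_I]
    module
  rw [hX, map_sub, map_smul, map_smul, mul_sub, mul_smul_comm, mul_smul_comm, herm, herm]
  · simp
  · rw [IsHermitian, conjTranspose_smul, conjTranspose_sub, conjTranspose_conjTranspose,
      Complex.star_def, Complex.conj_I, neg_smul, ← smul_neg, neg_sub]
  · rw [IsHermitian, conjTranspose_add, conjTranspose_conjTranspose, add_comm]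

omit [DecidableEq n] in
theorem exists_mul_eq_of_rank_eq {P σ : Matrix n n ℂ} (hσ : P * σ = σ) (hr : σ.rank = P.rank) :
    ∃ M, P = σ * M := by
  classical
  have hle : LinearMap.range σ.mulVecLin ≤ LinearMap.range P.mulVecLin := by
    rintro _ ⟨v, rfl⟩
    exact ⟨σ *ᵥ v, by simp [hσ]⟩
  have heq := Submodule.eq_of_le_of_finrank_eq hle hr
  have hcol : ∀ j, ∃ v, σ *ᵥ v = P *ᵥ Pi.single j 1 := fun j => by
    have : P *ᵥ Pi.single j 1 ∈ LinearMap.range σ.mulVecLin := by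
      rw [heq]; exact ⟨_, rfl⟩
    exact this
  choose v hv using hcol
  refine ⟨Matrix.of fun i j => v j i, ?_⟩
  ext i j
  have := congrFun (hv j) i
  rw [mulVec_single_one] at this
  exact this.symm

theorem rank_eq_trace_of_idempotent {P : Matrix n n ℂ} (hP : P * P = P) :
    (P.rank : ℂ) = P.trace := by
  have hproj : LinearMap.IsProj (LinearMap.range P.toLin') P.toLin' :=
    { map_mem := fun x => ⟨x, rfl⟩
      map_id := by
        rintro _ ⟨y, rfl⟩
        simp [hP] }
  rw [← Matrix.trace_toLin'_eq, hproj.trace]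
  rfl

/-- The stationary state `P∞ 1` is faithful on the non-decaying block. -/
theorem IsNonDecayingProjection.mul_eq_zero (hP : IsNonDecayingProjection Pinf P)
    (h : IsAsymptoticProjection (lindbladian H F κ) Pinf) (hH : H.IsHermitian)
    (hκ : ∀ l, 0 < κ l) {A : Matrix n n ℂ} (hA : A * Pinf 1 * Aᴴ = 0) : A * P = 0 := by
  obtain ⟨r, ⟨⟨σ, ⟨Y, rfl⟩, hσr⟩, -⟩, htr⟩ := hP.trace_eq_max_rank
  have hPσ : P * Pinf Y = Pinf Y := by
    rw [← hP.fixes _ ⟨Y, rfl⟩, ← mul_assoc, ← mul_assoc, hP.idempotent]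
  obtain ⟨M, hM⟩ := exists_mul_eq_of_rank_eq hPσ (by
    rw [hσr]
    exact_mod_cast (htr.symm.trans (rank_eq_trace_of_idempotent hP.idempotent).symm))
  rw [hM, ← mul_assoc, h.mul_apply_eq_zero hH hκ hA, zero_mul]

/-- The range of the orthogonal projection `P` is invariant under the operators `K` and `Fₗ`. -/
structure IsInvariantBlock (P K : Matrix n n ℂ) (F : ι → Matrix n n ℂ) : Prop where
  isHermitian : P.IsHermitian
  idempotent : P * P = P
  jump : ∀ l, P * F l * P = F l * P
  drift : P * K * P = K * P

omit [DecidableEq n] [Fintype ι] in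
theorem IsInvariantBlock.jump_star {K : Matrix n n ℂ} (hb : IsInvariantBlock P K F) (l : ι) :
    P * (F l)ᴴ * P = P * (F l)ᴴ := by
  simpa [conjTranspose_mul, hb.isHermitian.eq, mul_assoc] using congrArg conjTranspose (hb.jump l)

omit [DecidableEq n] [Fintype ι] in
theorem IsInvariantBlock.drift_star {K : Matrix n n ℂ} (hb : IsInvariantBlock P K F) :
    P * Kᴴ * P = P * Kᴴ := by
  simpa [conjTranspose_mul, hb.isHermitian.eq, mul_assoc] using congrArg conjTranspose hb.drift

namespace IsNonDecayingProjection

theorem proj_mul (hP : IsNonDecayingProjection Pinf P) (X : Matrix n n ℂ) :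
    P * Pinf X = Pinf X := by
  rw [← hP.fixes _ ⟨X, rfl⟩, ← mul_assoc, ← mul_assoc, hP.idempotent]

theorem mul_proj (hP : IsNonDecayingProjection Pinf P) (X : Matrix n n ℂ) :
    Pinf X * P = Pinf X := by
  rw [← hP.fixes _ ⟨X, rfl⟩, mul_assoc, hP.idempotent]

/-- Compressing `L(ρ) = 0`, `ρ = P∞ 1`, to the decaying corner gives
`∑ₗ κₗ (Q Fₗ) ρ (Q Fₗ)† = 0`, and compressing it to the lower left corner then gives `Q K ρ = 0`.
Since `ρ` is faithful on the block, `Q Fₗ P = 0` and `Q K P = 0`. -/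
theorem isInvariantBlock (hP : IsNonDecayingProjection Pinf P)
    (h : IsAsymptoticProjection (lindbladian H F κ) Pinf) (hH : H.IsHermitian)
    (hκ : ∀ l, 0 < κ l) : IsInvariantBlock P (noJumpGenerator H F κ) F := by
  set K := noJumpGenerator H F κ with hK
  set ρ := Pinf 1 with hρ
  set Q := 1 - P with hQ
  have hQH : Qᴴ = Q := by rw [hQ, conjTranspose_sub, conjTranspose_one, hP.isHermitian.eq]
  have hQρ : Q * ρ = 0 := by rw [hQ, sub_mul, one_mul, hρ, hP.proj_mul, sub_self]
  have hρQ : ρ * Q = 0 := by rw [hQ, mul_sub, mul_one, hρ, hP.mul_proj, sub_self]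
  have hstat : K * ρ + ρ * Kᴴ + ∑ l, (κ l : ℂ) • (F l * ρ * (F l)ᴴ) = 0 := by
    rw [← lindbladian_apply hH, h.map_apply]
  have hpos : ρ.PosSemidef := h.posSemidef_apply hH hκ PosSemidef.one
  have hsum : ∑ l, (κ l : ℂ) • (Q * F l * ρ * (Q * F l)ᴴ) = 0 := by
    have e : Q * (K * ρ + ρ * Kᴴ + ∑ l, (κ l : ℂ) • (F l * ρ * (F l)ᴴ)) * Q = 0 := by
      rw [hstat, mul_zero, zero_mul]
    rw [mul_add, mul_add, ← mul_assoc Q ρ, hQρ, zero_mul, add_zero, add_mul, mul_assoc Q,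
      mul_assoc K, hρQ, mul_zero, mul_zero, zero_add, Finset.mul_sum, Finset.sum_mul] at e
    rw [← e]
    refine Finset.sum_congr rfl fun l _ => ?_
    simp only [conjTranspose_mul, hQH, mul_smul_comm, smul_mul_assoc, mul_assoc]
  have hQF : ∀ l, Q * F l * P = 0 := by
    intro l
    refine hP.mul_eq_zero h hH hκ ?_
    have hnn : ∀ k ∈ Finset.univ, ((κ k : ℂ) • (Q * F k * ρ * (Q * F k)ᴴ)).PosSemidef :=
      fun k _ => (hpos.mul_mul_conjTranspose_same _).smul (by exact_mod_cast (hκ k).le)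
    have hz : (κ l : ℂ) • (Q * F l * ρ * (Q * F l)ᴴ) = 0 := by
      open scoped MatrixOrder in
      exact (Finset.sum_eq_zero_iff_of_nonneg
        fun k hk => nonneg_iff_posSemidef.2 (hnn k hk)).1 hsum l (Finset.mem_univ l)
    exact (smul_eq_zero.1 hz).resolve_left (by exact_mod_cast (hκ l).ne')
  have hQFρ : ∀ l, Q * (F l * ρ * (F l)ᴴ) = 0 := fun l => by
    rw [hρ, ← hP.proj_mul, ← mul_assoc, ← mul_assoc, ← mul_assoc, hQF, zero_mul, zero_mul]
  have hQK : Q * K * P = 0 := by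
    refine hP.mul_eq_zero h hH hκ ?_
    have e : Q * (K * ρ + ρ * Kᴴ + ∑ l, (κ l : ℂ) • (F l * ρ * (F l)ᴴ)) = 0 := by
      rw [hstat, mul_zero]
    simp only [mul_add, Finset.mul_sum, mul_smul_comm, hQFρ, smul_zero, Finset.sum_const_zero,
      add_zero] at e
    rw [← mul_assoc Q ρ, hQρ, zero_mul, add_zero, ← mul_assoc] at e
    rw [e, zero_mul]
  refine ⟨hP.isHermitian, hP.idempotent, fun l => ?_, ?_⟩
  · have := hQF l
    rw [hQ, sub_mul, sub_mul, one_mul, sub_eq_zero] at this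
    exact this.symm
  · rw [hQ, sub_mul, sub_mul, one_mul, sub_eq_zero] at hQK
    exact hQK.symm

end IsNonDecayingProjection

end Support

/-! ### Conserved quantities of the non-decaying block -/

section Conserved

variable {n ι : Type*} [Fintype n] [DecidableEq n] [Fintype ι]

/-- The adjoint `T†` of a superoperator for the bilinear pairing `(Y, X) ↦ tr (Y X)`. -/
def traceDual (T : SuperOp n) (Y : Matrix n n ℂ) : Matrix n n ℂ :=
  Matrix.of fun i j => (Y * T (Matrix.single j i 1)).trace

theorem trace_traceDual_mul (T : SuperOp n) (Y X : Matrix n n ℂ) :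
    (traceDual T Y * X).trace = (Y * T X).trace := by
  conv_rhs => rw [Matrix.matrix_eq_sum_single X]
  simp only [map_sum, Finset.mul_sum, trace_sum]
  rw [Finset.sum_comm, Matrix.trace]
  simp only [Matrix.diag_apply, Matrix.mul_apply, traceDual, Matrix.of_apply]
  refine Finset.sum_congr rfl fun i _ => Finset.sum_congr rfl fun j _ => ?_
  rw [show Matrix.single j i (X j i) = X j i • Matrix.single j i (1 : ℂ) by
    rw [Matrix.smul_single, smul_eq_mul, mul_one], map_smul, mul_smul_comm, trace_smul,
    smul_eq_mul, mul_comm]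

theorem traceDual_conjTranspose {T : SuperOp n} (hT : ∀ X, T Xᴴ = (T X)ᴴ) (Y : Matrix n n ℂ) :
    traceDual T Yᴴ = (traceDual T Y)ᴴ := by
  refine Matrix.ext_iff_trace_mul_right.2 fun X => ?_
  rw [trace_traceDual_mul, ← conjTranspose_conjTranspose X, hT, ← conjTranspose_mul,
    ← conjTranspose_mul, trace_conjTranspose, trace_conjTranspose, trace_mul_comm,
    ← trace_traceDual_mul, trace_mul_comm]

/-- The Lindbladian in the Heisenberg picture, `J ↦ K† J + J K + ∑ₗ κₗ Fₗ† J Fₗ`. -/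
noncomputable def heisenberg (K : Matrix n n ℂ) (F : ι → Matrix n n ℂ) (κ : ι → ℝ)
    (J : Matrix n n ℂ) : Matrix n n ℂ :=
  Kᴴ * J + J * K + ∑ l, (κ l : ℂ) • ((F l)ᴴ * J * F l)

variable {H : Matrix n n ℂ} {F : ι → Matrix n n ℂ} {κ : ι → ℝ} {Pinf : SuperOp n}
  {P K J : Matrix n n ℂ}

theorem trace_mul_lindbladian (hH : H.IsHermitian) (J X : Matrix n n ℂ) :
    (J * lindbladian H F κ X).trace =
      (heisenberg (noJumpGenerator H F κ) F κ J * X).trace := by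
  rw [lindbladian_apply hH, heisenberg]
  simp only [mul_add, add_mul, trace_add, Finset.mul_sum, Finset.sum_mul, trace_sum,
    mul_smul_comm, smul_mul_assoc, trace_smul]
  have h1 : (J * (X * (noJumpGenerator H F κ)ᴴ)).trace =
      ((noJumpGenerator H F κ)ᴴ * J * X).trace := by
    rw [← mul_assoc, trace_mul_comm, mul_assoc]
  have h2 : ∀ l, (J * (F l * X * (F l)ᴴ)).trace = ((F l)ᴴ * J * F l * X).trace := fun l => by
    rw [← mul_assoc, trace_mul_comm]
    simp only [mul_assoc]
  simp only [h1, h2]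
  simp only [mul_assoc]
  ring

omit [DecidableEq n] in
theorem heisenberg_conjTranspose (K : Matrix n n ℂ) (F : ι → Matrix n n ℂ) (κ : ι → ℝ)
    (J : Matrix n n ℂ) : heisenberg K F κ Jᴴ = (heisenberg K F κ J)ᴴ := by
  simp only [heisenberg, conjTranspose_add, conjTranspose_mul, conjTranspose_conjTranspose,
    conjTranspose_sum, conjTranspose_smul, Complex.star_def, Complex.conj_ofReal, mul_assoc]
  rw [add_comm (Kᴴ * Jᴴ)]

/-- The dissipation identity: the failure of the Heisenberg generator to be a derivation on `J† J`
is the positive form `∑ₗ κₗ [Fₗ, J]† [Fₗ, J]`. -/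
theorem dissipation (hH : H.IsHermitian) (J : Matrix n n ℂ) :
    heisenberg (noJumpGenerator H F κ) F κ (Jᴴ * J) -
        Jᴴ * heisenberg (noJumpGenerator H F κ) F κ J -
        heisenberg (noJumpGenerator H F κ) F κ Jᴴ * J =
      ∑ l, (κ l : ℂ) • ((F l * J - J * F l)ᴴ * (F l * J - J * F l)) := by
  set K := noJumpGenerator H F κ
  have hK : ∑ l, (κ l : ℂ) • (Jᴴ * ((F l)ᴴ * F l) * J) = -(Jᴴ * (K + Kᴴ) * J) := by
    rw [noJumpGenerator_add_conjTranspose hH]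
    simp only [mul_neg, neg_mul, neg_neg, Finset.mul_sum, Finset.sum_mul, mul_smul_comm,
      smul_mul_assoc]
  have hterm : ∀ l, (κ l : ℂ) • ((F l * J - J * F l)ᴴ * (F l * J - J * F l)) =
      (κ l : ℂ) • (Jᴴ * ((F l)ᴴ * F l) * J) + (κ l : ℂ) • ((F l)ᴴ * (Jᴴ * J) * F l) -
        (κ l : ℂ) • (Jᴴ * ((F l)ᴴ * J * F l)) - (κ l : ℂ) • ((F l)ᴴ * Jᴴ * F l * J) := by
    intro l
    simp only [conjTranspose_sub, conjTranspose_mul, sub_mul, mul_sub, smul_sub, mul_assoc]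
    abel
  simp only [hterm, Finset.sum_sub_distrib, Finset.sum_add_distrib, hK]
  simp only [heisenberg, mul_add, add_mul, Finset.mul_sum, Finset.sum_mul, mul_smul_comm,
    smul_mul_assoc, mul_assoc]
  abel

/-- `J` is supported on the block of `P` and commutes there with `Fₗ`, `Fₗ†`, `K` and `K†`. -/
structure CommutesOnBlock (P K : Matrix n n ℂ) (F : ι → Matrix n n ℂ) (J : Matrix n n ℂ) :
    Prop where
  proj_mul : P * J = J
  mul_proj : J * P = J
  jump : ∀ l, F l * J = J * F l * P
  jump_star : ∀ l, J * (F l)ᴴ = P * (F l)ᴴ * J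
  drift : K * J = J * K * P
  drift_star : J * Kᴴ = P * Kᴴ * J

/-- An operator on the block which is conserved by the compressed dynamics commutes with the
compressed jump operators: pairing the dissipation identity with the stationary state
`ρ = P∞ 1` leaves `∑ₗ κₗ tr ([Fₗ, J] ρ [Fₗ, J]†) = 0`, and `ρ` is faithful on the block. -/
theorem jump_commute_of_conserved (hP : IsNonDecayingProjection Pinf P)
    (h : IsAsymptoticProjection (lindbladian H F κ) Pinf) (hH : H.IsHermitian)
    (hκ : ∀ l, 0 < κ l) (hPJ : P * J = J) (hJP : J * P = J)
    (hcons : P * heisenberg (noJumpGenerator H F κ) F κ J * P = 0) (l : ι) :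
    F l * J = J * F l * P := by
  set K := noJumpGenerator H F κ with hK
  set ρ := Pinf 1 with hρ
  have hρpos : ρ.PosSemidef := h.posSemidef_apply hH hκ PosSemidef.one
  have hPρ : P * ρ = ρ := hP.proj_mul 1
  have hρP : ρ * P = ρ := hP.mul_proj 1
  have hJsP : Jᴴ * P = Jᴴ := by
    rw [← hP.isHermitian.eq, ← conjTranspose_mul, hPJ]
  have hcons' : P * heisenberg K F κ Jᴴ * P = 0 := by
    rw [heisenberg_conjTranspose, ← conjTranspose_eq_zero, conjTranspose_mul, conjTranspose_mul,
      conjTranspose_conjTranspose, hP.isHermitian.eq, ← mul_assoc, hcons]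
  have h0 : (heisenberg K F κ (Jᴴ * J) * ρ).trace = 0 := by
    rw [← trace_mul_lindbladian hH, hρ, h.map_apply, mul_zero, trace_zero]
  have h1 : (Jᴴ * heisenberg K F κ J * ρ).trace = 0 := by
    rw [← hJsP, ← hPρ, show Jᴴ * P * heisenberg K F κ J * (P * ρ) =
      Jᴴ * (P * heisenberg K F κ J * P) * ρ by simp only [mul_assoc], hcons, mul_zero, zero_mul,
      trace_zero]
  have h2 : (heisenberg K F κ Jᴴ * J * ρ).trace = 0 := by
    have e : P * (heisenberg K F κ Jᴴ * J * ρ) = P * heisenberg K F κ Jᴴ * P * J * ρ := by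
      rw [mul_assoc _ P J, hPJ]
      simp only [mul_assoc]
    rw [← hρP, ← mul_assoc, trace_mul_comm, e, hcons', zero_mul, zero_mul, trace_zero]
  have hsum : ∑ l, ((κ l : ℂ) • ((F l * J - J * F l) * ρ * (F l * J - J * F l)ᴴ)).trace = 0 := by
    have e := congrArg (fun M => (M * ρ).trace) (dissipation (H := H) (F := F) (κ := κ) hH J)
    simp only [sub_mul, trace_sub, ← hK, h0, h1, h2, sub_zero, Finset.sum_mul, trace_sum] at e
    rw [e]
    refine Finset.sum_congr rfl fun l _ => ?_
    rw [trace_smul, smul_mul_assoc, trace_smul, trace_mul_comm]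
    simp only [mul_assoc]
  have hnn : ∀ k ∈ Finset.univ,
      0 ≤ ((κ k : ℂ) • ((F k * J - J * F k) * ρ * (F k * J - J * F k)ᴴ)).trace := fun k _ =>
    ((hρpos.mul_mul_conjTranspose_same _).smul (by exact_mod_cast (hκ k).le)).trace_nonneg
  have hz := (Finset.sum_eq_zero_iff_of_nonneg hnn).1 hsum l (Finset.mem_univ l)
  rw [trace_smul, smul_eq_mul, mul_eq_zero] at hz
  have hz' := hz.resolve_left (by exact_mod_cast (hκ l).ne')
  rw [(hρpos.mul_mul_conjTranspose_same _).trace_eq_zero_iff] at hz'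
  have := hP.mul_eq_zero h hH hκ hz'
  rw [sub_mul, sub_eq_zero, mul_assoc, hJP] at this
  exact this

theorem commutesOnBlock_of_conserved (hP : IsNonDecayingProjection Pinf P)
    (h : IsAsymptoticProjection (lindbladian H F κ) Pinf) (hH : H.IsHermitian)
    (hκ : ∀ l, 0 < κ l) (hPJ : P * J = J) (hJP : J * P = J)
    (hcons : P * heisenberg (noJumpGenerator H F κ) F κ J * P = 0) :
    CommutesOnBlock P (noJumpGenerator H F κ) F J := by
  have hb := hP.isInvariantBlock h hH hκ
  set K := noJumpGenerator H F κ with hK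
  -- Everything is proved for `J` and `J†` at once; the relations for `Fₗ†` and `K†` are adjoint.
  have key : ∀ J : Matrix n n ℂ, P * J = J → J * P = J → P * heisenberg K F κ J * P = 0 →
      (∀ l, F l * J = J * F l * P) ∧ K * J = J * K * P := by
    intro J hPJ hJP hcons
    have hj := jump_commute_of_conserved hP h hH hκ hPJ hJP hcons
    refine ⟨hj, ?_⟩
    have hsum : ∀ l, P * ((F l)ᴴ * J * F l) * P = P * ((F l)ᴴ * F l) * J := fun l => by
      simp only [mul_assoc]
      rw [← mul_assoc J, ← hj]
    have e1 : P * (K + Kᴴ) * J = -∑ l, (κ l : ℂ) • (P * ((F l)ᴴ * F l) * J) := by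
      rw [noJumpGenerator_add_conjTranspose hH]
      simp only [mul_neg, neg_mul, Finset.mul_sum, Finset.sum_mul, mul_smul_comm, smul_mul_assoc]
    have e2 := hcons
    simp only [heisenberg, mul_add, add_mul, Finset.mul_sum, Finset.sum_mul, mul_smul_comm,
      smul_mul_assoc, hsum] at e2 e1
    rw [← neg_eq_iff_eq_neg] at e1
    rw [← e1, mul_assoc P (_ * J), mul_assoc _ J P, hJP, ← mul_assoc, ← mul_assoc P J, hPJ] at e2
    have e3 : P * K * J = K * J := by
      rw [← hPJ, ← mul_assoc, hb.drift, mul_assoc]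
    rw [e3] at e2
    rw [← sub_eq_zero, ← neg_eq_zero, ← e2]
    abel
  have hPJs : P * Jᴴ = Jᴴ := by
    rw [← hP.isHermitian.eq, ← conjTranspose_mul, hJP]
  have hJsP : Jᴴ * P = Jᴴ := by
    rw [← hP.isHermitian.eq, ← conjTranspose_mul, hPJ]
  have hcons' : P * heisenberg K F κ Jᴴ * P = 0 := by
    rw [heisenberg_conjTranspose, ← conjTranspose_eq_zero, conjTranspose_mul, conjTranspose_mul,
      conjTranspose_conjTranspose, hP.isHermitian.eq, ← mul_assoc, hcons]
  obtain ⟨a1, a2⟩ := key J hPJ hJP hcons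
  obtain ⟨b1, b2⟩ := key Jᴴ hPJs hJsP hcons'
  refine ⟨hPJ, hJP, a1, fun l => ?_, a2, ?_⟩
  · simpa [conjTranspose_mul, hP.isHermitian.eq, mul_assoc] using congrArg conjTranspose (b1 l)
  · simpa [conjTranspose_mul, hP.isHermitian.eq, mul_assoc] using congrArg conjTranspose b2

end Conserved

/-! ### Invariant subspaces of the Lindbladian -/

section InvariantSubspaces

variable {n ι : Type*} [Fintype n] [DecidableEq n] [Fintype ι]
variable {H : Matrix n n ℂ} {F : ι → Matrix n n ℂ} {κ : ι → ℝ} {Pinf : SuperOp n}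
  {P K J ρ : Matrix n n ℂ}

theorem lindbladian_conjTranspose (hH : H.IsHermitian) (X : Matrix n n ℂ) :
    lindbladian H F κ Xᴴ = (lindbladian H F κ X)ᴴ := by
  simp only [lindbladian_apply hH, conjTranspose_add, conjTranspose_mul,
    conjTranspose_conjTranspose, conjTranspose_sum, conjTranspose_smul, Complex.star_def,
    Complex.conj_ofReal, mul_assoc]
  rw [add_comm (noJumpGenerator H F κ * Xᴴ)]

theorem proj_mul_lindbladian (hH : H.IsHermitian)
    (hb : IsInvariantBlock P (noJumpGenerator H F κ) F) {Z : Matrix n n ℂ} (hZ : P * Z = Z) :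
    P * lindbladian H F κ Z = lindbladian H F κ Z := by
  have h1 : P * (noJumpGenerator H F κ * Z) = noJumpGenerator H F κ * Z := by
    rw [← hZ, ← mul_assoc, ← mul_assoc, hb.drift, mul_assoc]
  have h2 : ∀ l, P * (F l * Z * (F l)ᴴ) = F l * Z * (F l)ᴴ := fun l => by
    rw [← hZ, ← mul_assoc, ← mul_assoc, ← mul_assoc, hb.jump, mul_assoc (F l)]
  rw [lindbladian_apply hH, mul_add, mul_add, h1, ← mul_assoc P Z, hZ, Finset.mul_sum]
  simp only [mul_smul_comm, h2]

theorem lindbladian_mul_proj (hH : H.IsHermitian)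
    (hb : IsInvariantBlock P (noJumpGenerator H F κ) F) {Z : Matrix n n ℂ} (hZ : Z * P = Z) :
    lindbladian H F κ Z * P = lindbladian H F κ Z := by
  have hZ' : P * Zᴴ = Zᴴ := by rw [← hb.isHermitian.eq, ← conjTranspose_mul, hZ]
  have := congrArg conjTranspose (proj_mul_lindbladian hH hb hZ')
  rwa [conjTranspose_mul, hb.isHermitian.eq, lindbladian_conjTranspose hH,
    conjTranspose_conjTranspose] at this

/-- The three non-decaying corners form an invariant subspace of the Lindbladian: it is the sum of
the invariant subspaces of operators `Z` with `P Z = Z` and with `Z P = Z`. -/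
theorem corner_lindbladian_eq_zero (hH : H.IsHermitian)
    (hb : IsInvariantBlock P (noJumpGenerator H F κ) F) {X : Matrix n n ℂ}
    (hX : (1 - P) * X * (1 - P) = 0) : (1 - P) * lindbladian H F κ X * (1 - P) = 0 := by
  have e : X = P * X + (1 - P) * X * P := by
    rw [mul_sub, mul_one, sub_eq_zero] at hX
    rw [← hX, sub_mul, one_mul, add_sub_cancel]
  have h1 := proj_mul_lindbladian hH hb (Z := P * X) (by rw [← mul_assoc, hb.idempotent])
  have h2 := lindbladian_mul_proj hH hb (Z := (1 - P) * X * P) (by rw [mul_assoc, hb.idempotent])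
  have hQP : (1 - P) * P = 0 := by rw [sub_mul, one_mul, hb.idempotent, sub_self]
  have hPQ : P * (1 - P) = 0 := by rw [mul_sub, mul_one, hb.idempotent, sub_self]
  rw [e, map_add, ← h1, ← h2, mul_add, ← mul_assoc, hQP, zero_mul, zero_add, mul_assoc, mul_assoc,
    hPQ, mul_zero, mul_zero]

/-! ### Conserved quantities and the asymptotic projection -/

/-- Pairing with the compression of `P∞† Y` agrees with pairing with `P∞† Y` on the block. -/
theorem trace_compression_mul (Pinf : SuperOp n) (P Y : Matrix n n ℂ)
    {Z : Matrix n n ℂ} (hl : P * Z = Z) (hr : Z * P = Z) :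
    (P * traceDual Pinf Y * P * Z).trace = (Y * Pinf Z).trace := by
  rw [mul_assoc, hl, mul_assoc, trace_mul_comm, mul_assoc, hr, trace_traceDual_mul]

namespace IsNonDecayingProjection

theorem corner_apply (hP : IsNonDecayingProjection Pinf P) (X : Matrix n n ℂ) :
    (1 - P) * Pinf X * (1 - P) = 0 := by
  rw [sub_mul, hP.proj_mul, one_mul, sub_self, zero_mul]

theorem commutesOnBlock_traceDual (hP : IsNonDecayingProjection Pinf P)
    (h : IsAsymptoticProjection (lindbladian H F κ) Pinf) (hH : H.IsHermitian)
    (hκ : ∀ l, 0 < κ l) (Y : Matrix n n ℂ) :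
    CommutesOnBlock P (noJumpGenerator H F κ) F (P * traceDual Pinf Y * P) := by
  have hb := hP.isInvariantBlock h hH hκ
  refine commutesOnBlock_of_conserved hP h hH hκ ?_ ?_ ?_
  · rw [← mul_assoc, ← mul_assoc, hP.idempotent]
  · rw [mul_assoc, hP.idempotent]
  · refine Matrix.ext_iff_trace_mul_right.2 fun X => ?_
    set J := P * traceDual Pinf Y * P with hJ
    have e1 : (P * heisenberg (noJumpGenerator H F κ) F κ J * P * X).trace =
        (J * lindbladian H F κ (P * X * P)).trace := by
      rw [trace_mul_lindbladian hH, mul_assoc _ P X, mul_assoc P, trace_mul_comm P]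
      simp only [mul_assoc]
    have hl := proj_mul_lindbladian hH hb (Z := P * X * P)
      (by rw [← mul_assoc, ← mul_assoc, hb.idempotent])
    have hr := lindbladian_mul_proj hH hb (Z := P * X * P) (by rw [mul_assoc, hb.idempotent])
    rw [e1, hJ, mul_assoc, hl, mul_assoc, trace_mul_comm, mul_assoc, hr, trace_traceDual_mul,
      h.apply_map, mul_zero, zero_mul]

end IsNonDecayingProjection

theorem CommutesOnBlock.heisenberg_mul_proj (hH : H.IsHermitian)
    (hJ : CommutesOnBlock P (noJumpGenerator H F κ) F J) :
    heisenberg (noJumpGenerator H F κ) F κ J * P = 0 := by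
  have h1 : ∀ l, (F l)ᴴ * J * F l * P = (F l)ᴴ * F l * J := fun l => by
    rw [mul_assoc, mul_assoc, ← mul_assoc J, ← hJ.jump, mul_assoc]
  have h2 : (noJumpGenerator H F κ)ᴴ * J + noJumpGenerator H F κ * J =
      -∑ l, (κ l : ℂ) • ((F l)ᴴ * F l * J) := by
    rw [← add_mul, add_comm, noJumpGenerator_add_conjTranspose hH]
    simp only [neg_mul, Finset.sum_mul, smul_mul_assoc]
  rw [heisenberg, add_mul, add_mul, mul_assoc, hJ.mul_proj, ← hJ.drift, h2, Finset.sum_mul]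
  simp only [smul_mul_assoc, h1, neg_add_cancel]

theorem CommutesOnBlock.lindbladian_mul_left (hH : H.IsHermitian)
    (hJ : CommutesOnBlock P (noJumpGenerator H F κ) F J) (hρ : P * ρ = ρ) :
    lindbladian H F κ (J * ρ) = J * lindbladian H F κ ρ := by
  have h1 : noJumpGenerator H F κ * (J * ρ) = J * (noJumpGenerator H F κ * ρ) := by
    rw [← mul_assoc, hJ.drift, mul_assoc, hρ, mul_assoc]
  have h2 : ∀ l, F l * (J * ρ) = J * (F l * ρ) := fun l => by
    rw [← mul_assoc, hJ.jump, mul_assoc, hρ, mul_assoc]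
  simp only [lindbladian_apply hH, mul_add, Finset.mul_sum, mul_smul_comm, h1, h2, mul_assoc]

theorem CommutesOnBlock.lindbladian_mul_right (hH : H.IsHermitian)
    (hJ : CommutesOnBlock P (noJumpGenerator H F κ) F J) (hρ : ρ * P = ρ) :
    lindbladian H F κ (ρ * J) = lindbladian H F κ ρ * J := by
  have h1 : ρ * J * (noJumpGenerator H F κ)ᴴ = ρ * (noJumpGenerator H F κ)ᴴ * J := by
    rw [mul_assoc, hJ.drift_star, ← mul_assoc, ← mul_assoc, hρ]
  have h2 : ∀ l, F l * (ρ * J) * (F l)ᴴ = F l * ρ * (F l)ᴴ * J := fun l => by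
    rw [mul_assoc, mul_assoc ρ, hJ.jump_star, ← mul_assoc ρ, ← mul_assoc ρ, hρ]
    simp only [mul_assoc]
  simp only [lindbladian_apply hH, add_mul, Finset.sum_mul, smul_mul_assoc, h1, h2]
  rw [mul_assoc (noJumpGenerator H F κ)]

namespace IsNonDecayingProjection

/-- Coherences between the block and its complement do not survive: the functional
`Z ↦ tr (J Z)` of a conserved quantity `J` is conserved on the invariant subspace `P Z = Z`, and
it vanishes on `P Z Q`. -/
theorem apply_eq_zero_of_mul_proj (hP : IsNonDecayingProjection Pinf P)
    (h : IsAsymptoticProjection (lindbladian H F κ) Pinf) (hH : H.IsHermitian)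
    (hκ : ∀ l, 0 < κ l) {Z : Matrix n n ℂ} (hl : P * Z = Z) (hr : Z * P = 0) : Pinf Z = 0 := by
  have hb := hP.isInvariantBlock h hH hκ
  refine Matrix.ext_iff_trace_mul_left.2 fun Y => ?_
  have hJ := hP.commutesOnBlock_traceDual h hH hκ Y
  set J := P * traceDual Pinf Y * P with hJdef
  set W := drazinInverse (lindbladian H F κ) Pinf Z with hW
  have hPW : P * W = W := by
    have := h.drazinInverse_mem (N := LinearMap.mulLeft ℂ (1 - P)) (X := Z)
      (fun X hX => by
        rw [LinearMap.mulLeft_apply, sub_mul, one_mul, sub_eq_zero] at hX ⊢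
        exact (proj_mul_lindbladian hH hb hX.symm).symm)
      (fun X => by rw [LinearMap.mulLeft_apply, sub_mul, one_mul, hP.proj_mul, sub_self])
      (by rw [LinearMap.mulLeft_apply, sub_mul, one_mul, hl, sub_self])
    rw [LinearMap.mulLeft_apply, sub_mul, one_mul, sub_eq_zero] at this
    exact this.symm
  have h1 : (J * lindbladian H F κ W).trace = 0 := by
    rw [trace_mul_lindbladian hH, ← hPW, ← mul_assoc, hJ.heisenberg_mul_proj hH, zero_mul,
      trace_zero]
  have h2 : (J * Z).trace = 0 := by
    rw [hJdef, mul_assoc, hl, mul_assoc, trace_mul_comm, mul_assoc, hr, mul_zero, trace_zero]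
  have h3 : (J * Pinf Z).trace = (Y * Pinf Z).trace := by
    rw [hJdef, trace_compression_mul Pinf P Y (hP.proj_mul Z) (hP.mul_proj Z), h.apply_apply]
  rw [h.eq_apply_add Z, mul_add, trace_add, h1, add_zero, h3] at h2
  rw [h2, mul_zero, trace_zero]

theorem apply_eq_apply_compression (hP : IsNonDecayingProjection Pinf P)
    (h : IsAsymptoticProjection (lindbladian H F κ) Pinf) (hH : H.IsHermitian)
    (hκ : ∀ l, 0 < κ l) {X : Matrix n n ℂ} (hX : (1 - P) * X * (1 - P) = 0) :
    Pinf X = Pinf (P * X * P) := by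
  have hQP : (1 - P) * P = 0 := by rw [sub_mul, one_mul, hP.idempotent, sub_self]
  have hQH : (1 - P)ᴴ = 1 - P := by rw [conjTranspose_sub, conjTranspose_one, hP.isHermitian.eq]
  have e : X = P * X * P + P * X * (1 - P) + (P * Xᴴ * (1 - P))ᴴ := by
    rw [conjTranspose_mul, conjTranspose_mul, conjTranspose_conjTranspose, hP.isHermitian.eq, hQH,
      ← add_zero (_ + _), ← hX]
    noncomm_ring
  have hz : ∀ M : Matrix n n ℂ, Pinf (P * M * (1 - P)) = 0 := fun M =>
    hP.apply_eq_zero_of_mul_proj h hH hκ (by rw [← mul_assoc, ← mul_assoc, hP.idempotent])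
      (by rw [mul_assoc, hQP, mul_zero])
  conv_lhs => rw [e]
  rw [map_add, map_add, hz, h.apply_conjTranspose (lindbladian_conjTranspose hH), hz,
    conjTranspose_zero, add_zero, add_zero]

/-- The conserved quantities of the block determine the asymptotic state. -/
theorem apply_eq_apply_of_trace (hP : IsNonDecayingProjection Pinf P)
    (h : IsAsymptoticProjection (lindbladian H F κ) Pinf) (hH : H.IsHermitian)
    (hκ : ∀ l, 0 < κ l) {X Z : Matrix n n ℂ} (hX : (1 - P) * X * (1 - P) = 0)
    (hZ : (1 - P) * Z * (1 - P) = 0)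
    (htr : ∀ J, CommutesOnBlock P (noJumpGenerator H F κ) F J → (J * X).trace = (J * Z).trace) :
    Pinf X = Pinf Z := by
  rw [hP.apply_eq_apply_compression h hH hκ hX, hP.apply_eq_apply_compression h hH hκ hZ]
  refine Matrix.ext_iff_trace_mul_left.2 fun Y => ?_
  have hJ := hP.commutesOnBlock_traceDual h hH hκ Y
  have hc : ∀ X : Matrix n n ℂ, (P * traceDual Pinf Y * P * X).trace =
      (Y * Pinf (P * X * P)).trace := fun X => by
    rw [← trace_compression_mul Pinf P Y (by rw [← mul_assoc, ← mul_assoc, hP.idempotent])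
      (by rw [mul_assoc, hP.idempotent]), ← mul_assoc, ← mul_assoc, mul_assoc _ P P,
      hP.idempotent, trace_mul_comm _ P, ← mul_assoc, ← mul_assoc, ← mul_assoc, hP.idempotent]
  rw [← hc, ← hc, htr _ hJ]

theorem mul_left_mem (hP : IsNonDecayingProjection Pinf P)
    (h : IsAsymptoticProjection (lindbladian H F κ) Pinf) (hH : H.IsHermitian)
    (hJ : CommutesOnBlock P (noJumpGenerator H F κ) F J)
    (hρ : ρ ∈ asymptoticSubspace Pinf) : J * ρ ∈ asymptoticSubspace Pinf := by
  have hPρ : P * ρ = ρ := by rw [← h.apply_of_mem hρ, hP.proj_mul]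
  rw [h.mem_asymptoticSubspace_iff] at hρ ⊢
  rw [hJ.lindbladian_mul_left hH hPρ, hρ, mul_zero]

theorem mul_right_mem (hP : IsNonDecayingProjection Pinf P)
    (h : IsAsymptoticProjection (lindbladian H F κ) Pinf) (hH : H.IsHermitian)
    (hJ : CommutesOnBlock P (noJumpGenerator H F κ) F J)
    (hρ : ρ ∈ asymptoticSubspace Pinf) : ρ * J ∈ asymptoticSubspace Pinf := by
  have hPρ : ρ * P = ρ := by rw [← h.apply_of_mem hρ, hP.mul_proj]
  rw [h.mem_asymptoticSubspace_iff] at hρ ⊢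
  rw [hJ.lindbladian_mul_right hH hPρ, hρ, zero_mul]

/-- For `A = P A P`, the operator `G = P (P∞† A) P` implements on `As(H)` the projected left and
right multiplications by `A`. It is the image of `A` under the conditional expectation onto the
conserved quantities, and the identity `P∞(A ρ) = G ρ` is tested against a conserved
quantity `J`: since `ρ J` is again asymptotic, `tr (J A ρ) = tr (A P∞(ρ J)) = tr (G ρ J)`. -/
theorem apply_hamSuper (hP : IsNonDecayingProjection Pinf P)
    (h : IsAsymptoticProjection (lindbladian H F κ) Pinf) (hH : H.IsHermitian)
    (hκ : ∀ l, 0 < κ l) (A : Matrix n n ℂ) (hρ : ρ ∈ asymptoticSubspace Pinf) :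
    Pinf (hamSuper A ρ) = hamSuper (P * traceDual Pinf A * P) ρ := by
  have hG := hP.commutesOnBlock_traceDual h hH hκ A
  set G := P * traceDual Pinf A * P with hGdef
  have hl : ∀ {σ}, σ ∈ asymptoticSubspace Pinf → P * σ = σ := fun hσ => by
    rw [← h.apply_of_mem hσ, hP.proj_mul]
  have hr : ∀ {σ}, σ ∈ asymptoticSubspace Pinf → σ * P = σ := fun hσ => by
    rw [← h.apply_of_mem hσ, hP.mul_proj]
  have hGA : ∀ {σ}, σ ∈ asymptoticSubspace Pinf → (G * σ).trace = (A * σ).trace := fun hσ => by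
    rw [hGdef, trace_compression_mul Pinf P A (hl hσ) (hr hσ), h.apply_of_mem hσ]
  have hmem : hamSuper G ρ ∈ asymptoticSubspace Pinf := by
    rw [hamSuper_apply]
    exact Submodule.smul_mem _ _
      (Submodule.sub_mem _ (hP.mul_left_mem h hH hG hρ) (hP.mul_right_mem h hH hG hρ))
  rw [← h.apply_of_mem hmem]
  have hcorner : ∀ B : Matrix n n ℂ, (1 - P) * hamSuper B ρ * (1 - P) = 0 := fun B => by
    have h1 : (1 - P) * ρ = 0 := by rw [sub_mul, one_mul, hl hρ, sub_self]
    have h2 : ρ * (1 - P) = 0 := by rw [mul_sub, mul_one, hr hρ, sub_self]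
    generalize 1 - P = Q at h1 h2 ⊢
    rw [hamSuper_apply, mul_smul_comm, smul_mul_assoc, mul_sub, ← mul_assoc Q ρ, h1,
      zero_mul, sub_zero, mul_assoc, mul_assoc, h2, mul_zero, mul_zero, smul_zero]
  refine hP.apply_eq_apply_of_trace h hH hκ (hcorner A) (hcorner G) fun J hJ => ?_
  have e1 : ∀ B : Matrix n n ℂ, (J * (B * ρ)).trace = (B * (ρ * J)).trace := fun B => by
    rw [trace_mul_comm, mul_assoc]
  have e2 : ∀ B : Matrix n n ℂ, (J * (ρ * B)).trace = (B * (J * ρ)).trace := fun B => by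
    rw [← mul_assoc, trace_mul_comm]
  simp only [hamSuper_apply, mul_smul_comm, mul_sub, trace_smul, trace_sub, e1, e2,
    hGA (hP.mul_left_mem h hH hJ hρ), hGA (hP.mul_right_mem h hH hJ hρ)]

end IsNonDecayingProjection

end InvariantSubspaces

/-! ### The perturbation -/

section Perturbation

variable {n ι : Type*} [Fintype n] [DecidableEq n] [Fintype ι]
variable {H : Matrix n n ℂ} {F : ι → Matrix n n ℂ} {κ : ι → ℝ} {Pinf : SuperOp n}
  {P K J ρ V : Matrix n n ℂ} {f : ι → Matrix n n ℂ}

theorem perturbation_apply (F : ι → Matrix n n ℂ) (κ : ι → ℝ) (V : Matrix n n ℂ)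
    (f : ι → Matrix n n ℂ) (ρ : Matrix n n ℂ) :
    perturbation F κ V f ρ = -Complex.I • (V * ρ - ρ * V) + ∑ l, (κ l : ℂ) •
      (F l * ρ * (f l)ᴴ + f l * ρ * (F l)ᴴ - (1 / 2 : ℂ) •
        (((f l)ᴴ * F l + (F l)ᴴ * f l) * ρ + ρ * ((f l)ᴴ * F l + (F l)ᴴ * f l))) := by
  simp [perturbation]

theorem corner_perturbation_eq_zero (hb : IsInvariantBlock P K F) (hl : P * ρ = ρ)
    (hr : ρ * P = ρ) : (1 - P) * perturbation F κ V f ρ * (1 - P) = 0 := by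
  have h1 : (1 - P) * ρ = 0 := by rw [sub_mul, one_mul, hl, sub_self]
  have h2 : ρ * (1 - P) = 0 := by rw [mul_sub, mul_one, hr, sub_self]
  have h3 : ∀ l, (1 - P) * F l * ρ = 0 := fun l => by
    rw [← hl, ← mul_assoc, sub_mul, sub_mul, hb.jump, one_mul, sub_self, zero_mul]
  have h4 : ∀ l, ρ * ((F l)ᴴ * (1 - P)) = 0 := fun l => by
    rw [← hr, mul_assoc, ← mul_assoc P, mul_sub, hb.jump_star, mul_one, sub_self, mul_zero]
  generalize 1 - P = Q at h1 h2 h3 h4 ⊢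
  have h5 : ∀ A, Q * (A * ρ) * Q = 0 := fun A => by
    rw [mul_assoc, mul_assoc, h2, mul_zero, mul_zero]
  have h6 : ∀ A, Q * (ρ * A) * Q = 0 := fun A => by
    rw [← mul_assoc, h1, zero_mul, zero_mul]
  have h7 : ∀ l, Q * (F l * ρ * (f l)ᴴ) * Q = 0 := fun l => by
    rw [← mul_assoc, ← mul_assoc, h3, zero_mul, zero_mul]
  have h8 : ∀ l, Q * (f l * ρ * (F l)ᴴ) * Q = 0 := fun l => by
    rw [mul_assoc, mul_assoc, mul_assoc, h4, mul_zero, mul_zero]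
  rw [perturbation_apply]
  simp only [mul_add, mul_sub Q, mul_smul_comm, add_mul _ _ Q, sub_mul _ _ Q, smul_mul_assoc,
    Finset.mul_sum, Finset.sum_mul, h5, h6, h7, h8, add_zero, sub_zero, smul_zero,
    Finset.sum_const_zero]

theorem perturbationHamiltonian_isHermitian (hP : P.IsHermitian) (hV : V.IsHermitian) :
    (perturbationHamiltonian P F κ V f).IsHermitian := by
  have hI : ∀ M : Matrix n n ℂ, Mᴴ = -M → ((Complex.I / 2) • M)ᴴ = (Complex.I / 2) • M := by
    intro M hM
    rw [conjTranspose_smul, hM, smul_neg, ← neg_smul]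
    congr 1
    simp [neg_div]
  rw [IsHermitian, perturbationHamiltonian, conjTranspose_add, hI]
  · simp only [cornerUL, sandwich_apply, conjTranspose_mul, hP.eq, hV.eq, mul_assoc]
  · simp only [conjTranspose_sum, conjTranspose_smul, conjTranspose_sub, conjTranspose_mul,
      conjTranspose_conjTranspose, Complex.star_def, Complex.conj_ofReal, ← Finset.sum_neg_distrib,
      ← smul_neg, neg_sub]

theorem perturbationHamiltonian_eq (hb : IsInvariantBlock P K F) :
    perturbationHamiltonian P F κ V f = P * (V + (Complex.I / 2) • ∑ l, (κ l : ℂ) •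
      ((F l)ᴴ * f l - (f l)ᴴ * F l)) * P := by
  have h1 : ∀ l, (P * F l * P)ᴴ * (P * f l * P) = P * ((F l)ᴴ * f l) * P := fun l => by
    have hPP := hb.idempotent
    rw [conjTranspose_mul, conjTranspose_mul, hb.isHermitian.eq, ← mul_assoc, ← mul_assoc,
      ← mul_assoc, mul_assoc _ P P, hPP, hb.jump_star, ← mul_assoc]
  have h2 : ∀ l, (P * f l * P)ᴴ * (P * F l * P) = P * ((f l)ᴴ * F l) * P := fun l => by
    rw [← conjTranspose_conjTranspose (P * F l * P), ← conjTranspose_mul, h1]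
    simp only [conjTranspose_mul, conjTranspose_conjTranspose, hb.isHermitian.eq, mul_assoc]
  simp only [perturbationHamiltonian, cornerUL, sandwich_apply, h1, h2, mul_add, add_mul,
    mul_smul_comm, smul_mul_assoc, Finset.mul_sum, Finset.sum_mul, mul_sub, sub_mul]

/-- A conserved quantity `J` of the block does not distinguish the perturbation from the
commutator with the perturbation Hamiltonian: moving `J` past `Fₗ` and `Fₗ†` under the trace
turns the dissipative terms into `(1/2) tr ((Fₗ† fₗ - fₗ† Fₗ) [ρ, J])`. -/
theorem CommutesOnBlock.trace_mul_perturbation (hJ : CommutesOnBlock P K F J)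
    (hb : IsInvariantBlock P K F) (hl : P * ρ = ρ) (hr : ρ * P = ρ) :
    (J * perturbation F κ V f ρ).trace =
      (J * hamSuper (perturbationHamiltonian P F κ V f) ρ).trace := by
  set E := V + (Complex.I / 2) • ∑ l, (κ l : ℂ) • ((F l)ᴴ * f l - (f l)ᴴ * F l) with hE
  have hcomp : (J * hamSuper (P * E * P) ρ).trace =
      -Complex.I * ((E * (ρ * J)).trace - (E * (J * ρ)).trace) := by
    have e1 : (J * (P * E * P * ρ)).trace = (E * (ρ * J)).trace := by
      rw [mul_assoc _ P, hl, mul_assoc P, ← mul_assoc J, hJ.mul_proj, trace_mul_comm, mul_assoc]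
    have e2 : (J * (ρ * (P * E * P))).trace = (E * (J * ρ)).trace := by
      rw [mul_assoc P, ← mul_assoc ρ, hr, ← mul_assoc, ← mul_assoc, trace_mul_comm, ← mul_assoc,
        ← mul_assoc, hJ.proj_mul, trace_mul_comm]
    rw [hamSuper_apply, mul_smul_comm, trace_smul, mul_sub, trace_sub, e1, e2, smul_eq_mul]
  have hc1 : ∀ A : Matrix n n ℂ, (J * (A * ρ)).trace = (A * (ρ * J)).trace := fun A => by
    rw [trace_mul_comm, mul_assoc]
  have hc2 : ∀ A : Matrix n n ℂ, (J * (ρ * A)).trace = (A * (J * ρ)).trace := fun A => by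
    rw [← mul_assoc, trace_mul_comm]
  have h1 : ∀ l, (J * (F l * ρ * (f l)ᴴ)).trace = ((f l)ᴴ * F l * (J * ρ)).trace := fun l => by
    have : J * F l * ρ = F l * (J * ρ) := by
      rw [← hl, ← mul_assoc, ← hJ.jump, mul_assoc, hl]
    rw [← mul_assoc, ← mul_assoc, this, trace_mul_comm, ← mul_assoc]
  have h2 : ∀ l, (J * (f l * ρ * (F l)ᴴ)).trace = ((F l)ᴴ * f l * (ρ * J)).trace := fun l => by
    have : ρ * (F l)ᴴ * J = ρ * J * (F l)ᴴ := by
      rw [mul_assoc ρ J, hJ.jump_star, ← mul_assoc, ← mul_assoc, hr]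
    rw [trace_mul_comm, mul_assoc, mul_assoc, ← mul_assoc ρ, this, ← mul_assoc, trace_mul_comm,
      ← mul_assoc]
  rw [perturbationHamiltonian_eq hb, hcomp, perturbation_apply]
  simp only [mul_add, mul_sub, mul_smul_comm, trace_add, trace_sub, trace_smul, hc1, hc2, h1, h2,
    Finset.mul_sum, trace_sum, hE, add_mul, smul_mul_assoc, Finset.sum_mul, sub_mul, smul_eq_mul]
  rw [add_sub_add_comm, ← Finset.sum_sub_distrib]
  congr 1
  refine Finset.sum_congr rfl fun l _ => ?_
  linear_combination (κ l : ℂ) / 2 * (((F l)ᴴ * f l * (ρ * J)).trace -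
    ((f l)ᴴ * F l * (ρ * J)).trace - (((F l)ᴴ * f l * (J * ρ)).trace -
      ((f l)ᴴ * F l * (J * ρ)).trace)) * Complex.I_mul_I

namespace IsNonDecayingProjection

theorem apply_perturbation (hP : IsNonDecayingProjection Pinf P)
    (h : IsAsymptoticProjection (lindbladian H F κ) Pinf) (hH : H.IsHermitian)
    (hκ : ∀ l, 0 < κ l) (V : Matrix n n ℂ) (f : ι → Matrix n n ℂ)
    (hρ : ρ ∈ asymptoticSubspace Pinf) :
    Pinf (perturbation F κ V f ρ) =
      hamSuper (P * traceDual Pinf (perturbationHamiltonian P F κ V f) * P) ρ := by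
  have hb := hP.isInvariantBlock h hH hκ
  have hl : P * ρ = ρ := by rw [← h.apply_of_mem hρ, hP.proj_mul]
  have hr : ρ * P = ρ := by rw [← h.apply_of_mem hρ, hP.mul_proj]
  rw [← hP.apply_hamSuper h hH hκ _ hρ]
  refine hP.apply_eq_apply_of_trace h hH hκ (corner_perturbation_eq_zero hb hl hr) ?_ fun J hJ =>
    hJ.trace_mul_perturbation hb hl hr
  have h1 : (1 - P) * ρ = 0 := by rw [sub_mul, one_mul, hl, sub_self]
  have h2 : ρ * (1 - P) = 0 := by rw [mul_sub, mul_one, hr, sub_self]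
  generalize 1 - P = Q at h1 h2 ⊢
  rw [hamSuper_apply, mul_smul_comm, smul_mul_assoc, mul_sub, ← mul_assoc Q ρ, h1,
    zero_mul, sub_zero, mul_assoc, mul_assoc, h2, mul_zero, mul_zero, smul_zero]

end IsNonDecayingProjection

end Perturbation

/-! ### Noiseless-subsystem blocks -/

section PartialTrace

variable {n d a : Type*} [Fintype n] [DecidableEq n] [Fintype d] [DecidableEq d] [Fintype a]
  [DecidableEq a]

omit [DecidableEq d] in
theorem trace_mul_kronecker_one (M : Matrix (d × a) (d × a) ℂ) (C : Matrix d d ℂ) :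
    (M * (C ⊗ₖ (1 : Matrix a a ℂ))).trace = (traceAx M * C).trace := by
  simp only [Matrix.trace, Matrix.diag_apply, Matrix.mul_apply, Fintype.sum_prod_type, traceAx,
    Matrix.of_apply, kroneckerMap_apply, Matrix.one_apply, mul_ite, mul_one, mul_zero,
    Finset.sum_ite_eq', Finset.mem_univ, if_true, Finset.sum_mul]
  exact Finset.sum_congr rfl fun i _ => Finset.sum_comm

theorem trace_mul_kronecker (M : Matrix (d × a) (d × a) ℂ) (C : Matrix d d ℂ)
    (ϱ : Matrix a a ℂ) :
    (M * (C ⊗ₖ ϱ)).trace = (traceAx (((1 : Matrix d d ℂ) ⊗ₖ ϱ) * M) * C).trace := by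
  rw [← trace_mul_kronecker_one, Matrix.mul_assoc, trace_mul_comm (_ ⊗ₖ _), Matrix.mul_assoc,
    ← mul_kronecker_mul, Matrix.mul_one, Matrix.one_mul]

theorem traceAx_kronecker_mul_comm (M : Matrix (d × a) (d × a) ℂ) (ϱ : Matrix a a ℂ) :
    traceAx (M * ((1 : Matrix d d ℂ) ⊗ₖ ϱ)) = traceAx (((1 : Matrix d d ℂ) ⊗ₖ ϱ) * M) := by
  refine Matrix.ext_iff_trace_mul_right.2 fun C => ?_
  rw [← trace_mul_kronecker, ← trace_mul_kronecker_one, Matrix.mul_assoc, ← mul_kronecker_mul,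
    Matrix.one_mul, Matrix.mul_one]

omit [DecidableEq n] in
theorem effectiveHamiltonian_isHermitian (W : Matrix n (d × a) ℂ) {ϱ : Matrix a a ℂ}
    {X : Matrix n n ℂ} (hϱ : ϱ.IsHermitian) (hX : X.IsHermitian) :
    (effectiveHamiltonian W ϱ X).IsHermitian := by
  have h : ∀ M : Matrix (d × a) (d × a) ℂ, (traceAx M)ᴴ = traceAx Mᴴ := fun M => by
    ext i j
    simp [traceAx, conjTranspose_apply]
  rw [IsHermitian, effectiveHamiltonian, h, ← traceAx_kronecker_mul_comm]
  simp only [conjTranspose_mul, conjTranspose_kronecker, conjTranspose_one, hϱ.eq, hX.eq,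
    conjTranspose_conjTranspose]
  rw [Matrix.mul_assoc Wᴴ X W]

end PartialTrace

section Blocks

variable {n ι K : Type*} [Fintype n] [DecidableEq n] [Fintype ι] [Fintype K]
  {d a : K → Type*} [∀ k, Fintype (d k)] [∀ k, DecidableEq (d k)]
  [∀ k, Fintype (a k)] [∀ k, DecidableEq (a k)]
  {W : ∀ k, Matrix n (d k × a k) ℂ} {ϱ : ∀ k, Matrix (a k) (a k) ℂ}
  {H : Matrix n n ℂ} {F : ι → Matrix n n ℂ} {κ : ι → ℝ} {Pinf : SuperOp n} {P : Matrix n n ℂ}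

namespace IsNSDecomposition

theorem sum_mem {As : Submodule ℂ (Matrix n n ℂ)} (hW : IsNSDecomposition As W ϱ)
    (B : ∀ k, Matrix (d k) (d k) ℂ) : ∑ k, W k * (B k ⊗ₖ ϱ k) * (W k)ᴴ ∈ As :=
  (hW.mem_iff _).2 ⟨B, rfl⟩

theorem block_mem {As : Submodule ℂ (Matrix n n ℂ)} (hW : IsNSDecomposition As W ϱ) (k : K)
    (A : Matrix (d k) (d k) ℂ) : W k * (A ⊗ₖ ϱ k) * (W k)ᴴ ∈ As := by
  classical
  convert hW.sum_mem (Pi.single k A) using 1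
  rw [Finset.sum_eq_single k]
  · rw [Pi.single_eq_same]
  · intro l _ hl
    rw [Pi.single_eq_of_ne hl, zero_kronecker, Matrix.mul_zero, Matrix.zero_mul]
  · simp

theorem sum_mul_isometry {As : Submodule ℂ (Matrix n n ℂ)} (hW : IsNSDecomposition As W ϱ)
    (M : ∀ k, Matrix (d k × a k) (d k × a k) ℂ) (k : K) :
    (∑ l, W l * M l * (W l)ᴴ) * W k = W k * M k := by
  rw [Matrix.sum_mul, Finset.sum_eq_single k]
  · rw [Matrix.mul_assoc, hW.isometry, Matrix.mul_one]
  · intro l _ hl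
    rw [Matrix.mul_assoc, hW.orthogonal l k hl, Matrix.mul_zero]
  · simp

theorem mul_right_cancel {As : Submodule ℂ (Matrix n n ℂ)} (hW : IsNSDecomposition As W ϱ) {k : K}
    {M N : Matrix n (d k × a k) ℂ}
    (h : M * ((1 : Matrix (d k) (d k) ℂ) ⊗ₖ ϱ k) = N * ((1 : Matrix (d k) (d k) ℂ) ⊗ₖ ϱ k)) :
    M = N := by
  have hu : IsUnit ((1 : Matrix (d k) (d k) ℂ) ⊗ₖ ϱ k) :=
    (PosDef.one.kronecker (hW.posDef k)).isUnit
  obtain ⟨u, hu⟩ := hu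
  rw [← hu] at h
  have := congrArg (· * (↑u⁻¹ : Matrix (d k × a k) (d k × a k) ℂ)) h
  simpa only [Matrix.mul_assoc, Units.mul_inv, Matrix.mul_one] using this

theorem proj_mul (hW : IsNSDecomposition (asymptoticSubspace Pinf) W ϱ)
    (hP : IsNonDecayingProjection Pinf P) (k : K) : P * W k = W k := by
  obtain ⟨Y, hY⟩ := hW.sum_mem fun _ => 1
  have := congrArg (· * W k) (hP.proj_mul Y)
  simp only [hY] at this
  rw [Matrix.mul_assoc, hW.sum_mul_isometry, ← Matrix.mul_assoc] at this
  exact hW.mul_right_cancel this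

/-- The blocks fill the whole non-decaying subspace. -/
theorem sum_eq_proj (hW : IsNSDecomposition (asymptoticSubspace Pinf) W ϱ)
    (hP : IsNonDecayingProjection Pinf P)
    (h : IsAsymptoticProjection (lindbladian H F κ) Pinf) (hH : H.IsHermitian)
    (hκ : ∀ l, 0 < κ l) : ∑ k, W k * (W k)ᴴ = P := by
  obtain ⟨B, hB⟩ := (hW.mem_iff (Pinf 1)).1 ⟨1, rfl⟩
  have hs : ∀ k, (∑ l, W l * (W l)ᴴ) * W k = W k := fun k => by
    simpa only [Matrix.mul_one] using hW.sum_mul_isometry (fun _ => 1) k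
  have h1 : (1 - ∑ k, W k * (W k)ᴴ) * Pinf 1 = 0 := by
    rw [hB, Matrix.mul_sum]
    refine Finset.sum_eq_zero fun k _ => ?_
    rw [← Matrix.mul_assoc, ← Matrix.mul_assoc, Matrix.sub_mul, hs, Matrix.one_mul,
      sub_self, Matrix.zero_mul, Matrix.zero_mul]
  have h2 := hP.mul_eq_zero h hH hκ (A := 1 - ∑ k, W k * (W k)ᴴ) (by rw [h1, Matrix.zero_mul])
  have h3 : ∀ k, (W k)ᴴ * P = (W k)ᴴ := fun k => by
    rw [← hP.isHermitian.eq, ← conjTranspose_mul, hW.proj_mul hP]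
  rw [Matrix.sub_mul, Matrix.one_mul, sub_eq_zero, Matrix.sum_mul] at h2
  rw [h2]
  simp only [Matrix.mul_assoc, h3]

/-- On each block a conserved quantity has the form `B ⊗ 1`: its product with the full-rank
stationary state `⨁ₖ 1 ⊗ ϱₖ` is again asymptotic, hence of the form `⨁ₖ Bₖ ⊗ ϱₖ`. -/
theorem exists_mul_eq (hW : IsNSDecomposition (asymptoticSubspace Pinf) W ϱ)
    (hP : IsNonDecayingProjection Pinf P)
    (h : IsAsymptoticProjection (lindbladian H F κ) Pinf) (hH : H.IsHermitian)
    {J : Matrix n n ℂ} (hJ : CommutesOnBlock P (noJumpGenerator H F κ) F J) :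
    ∃ B : ∀ k, Matrix (d k) (d k) ℂ, ∀ k, J * W k = W k * (B k ⊗ₖ (1 : Matrix (a k) (a k) ℂ)) := by
  obtain ⟨B, hB⟩ := (hW.mem_iff _).1 (hP.mul_left_mem h hH hJ (hW.sum_mem fun _ => 1))
  refine ⟨B, fun k => hW.mul_right_cancel ?_⟩
  have := congrArg (· * W k) hB
  simp only [Matrix.mul_assoc J, hW.sum_mul_isometry] at this
  rw [Matrix.mul_assoc, this, Matrix.mul_assoc, ← mul_kronecker_mul, Matrix.mul_one, Matrix.one_mul]

theorem trace_block {As : Submodule ℂ (Matrix n n ℂ)} (hW : IsNSDecomposition As W ϱ)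
    {J : Matrix n n ℂ} {B : ∀ k, Matrix (d k) (d k) ℂ}
    (hB : ∀ k, J * W k = W k * (B k ⊗ₖ (1 : Matrix (a k) (a k) ℂ)))
    (k : K) (C : Matrix (d k) (d k) ℂ) :
    (J * (W k * (C ⊗ₖ ϱ k) * (W k)ᴴ)).trace = (B k * C).trace := by
  rw [← Matrix.mul_assoc, ← Matrix.mul_assoc, hB, trace_mul_comm, Matrix.mul_assoc (W k),
    ← Matrix.mul_assoc, hW.isometry, Matrix.one_mul, ← mul_kronecker_mul, Matrix.one_mul,
    trace_kronecker, hW.trace_one, mul_one]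

/-- The asymptotic projection on the non-decaying block is the sum of the partial traces. -/
theorem apply_compression (hW : IsNSDecomposition (asymptoticSubspace Pinf) W ϱ)
    (hP : IsNonDecayingProjection Pinf P)
    (h : IsAsymptoticProjection (lindbladian H F κ) Pinf) (hH : H.IsHermitian)
    (hκ : ∀ l, 0 < κ l) (X : Matrix n n ℂ) :
    Pinf (P * X * P) = ∑ k, W k * (traceAx ((W k)ᴴ * X * W k) ⊗ₖ ϱ k) * (W k)ᴴ := by
  have hmem := hW.sum_mem fun k => traceAx ((W k)ᴴ * X * W k)
  have hc := hP.corner_apply (∑ k, W k * (traceAx ((W k)ᴴ * X * W k) ⊗ₖ ϱ k) * (W k)ᴴ)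
  rw [h.apply_of_mem hmem] at hc
  rw [← h.apply_of_mem hmem]
  refine hP.apply_eq_apply_of_trace h hH hκ ?_ hc fun J hJ => ?_
  · rw [Matrix.mul_assoc, Matrix.mul_assoc _ P, Matrix.mul_sub P, Matrix.mul_one, hP.idempotent,
      sub_self, Matrix.mul_zero, Matrix.mul_zero]
  · obtain ⟨B, hB⟩ := hW.exists_mul_eq hP h hH hJ
    have e : (J * (P * X * P)).trace = (J * P * X).trace := by
      rw [← Matrix.mul_assoc, trace_mul_comm, ← Matrix.mul_assoc, hJ.proj_mul, Matrix.mul_assoc]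
    rw [e, ← hW.sum_eq_proj hP h hH hκ, Matrix.mul_sum, Matrix.sum_mul, Matrix.mul_sum, trace_sum,
      trace_sum]
    refine Finset.sum_congr rfl fun k _ => ?_
    rw [hW.trace_block hB, ← Matrix.mul_assoc, hB, Matrix.mul_assoc, trace_mul_comm,
      ← Matrix.mul_assoc, trace_mul_kronecker_one, trace_mul_comm]

end IsNSDecomposition

namespace IsNonDecayingProjection

/-- The generator of the effective evolution is Hermitian. -/
theorem traceDual_compression_isHermitian (hP : IsNonDecayingProjection Pinf P)
    (h : IsAsymptoticProjection (lindbladian H F κ) Pinf) (hH : H.IsHermitian)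
    {A : Matrix n n ℂ} (hA : A.IsHermitian) : (P * traceDual Pinf A * P).IsHermitian := by
  have := traceDual_conjTranspose (h.apply_conjTranspose (lindbladian_conjTranspose hH)) A
  rw [IsHermitian, conjTranspose_mul, conjTranspose_mul, hP.isHermitian.eq, ← this, hA.eq,
    Matrix.mul_assoc]

end IsNonDecayingProjection

namespace IsNSDecomposition

/-- The compressed conditional expectation of `A` acts on block `k` as the effective
Hamiltonian. -/
theorem traceDual_mul (hW : IsNSDecomposition (asymptoticSubspace Pinf) W ϱ)
    (hP : IsNonDecayingProjection Pinf P)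
    (h : IsAsymptoticProjection (lindbladian H F κ) Pinf) (hH : H.IsHermitian)
    (hκ : ∀ l, 0 < κ l) (A : Matrix n n ℂ) (k : K) :
    P * traceDual Pinf A * P * W k =
      W k * (effectiveHamiltonian (W k) (ϱ k) A ⊗ₖ (1 : Matrix (a k) (a k) ℂ)) := by
  obtain ⟨B, hB⟩ := hW.exists_mul_eq hP h hH (hP.commutesOnBlock_traceDual h hH hκ A)
  have hBk : B k = effectiveHamiltonian (W k) (ϱ k) A := by
    refine Matrix.ext_iff_trace_mul_right.2 fun C => ?_
    have hmem := hW.block_mem k C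
    have hfix := h.apply_of_mem hmem
    rw [← hW.trace_block hB, trace_compression_mul Pinf P A (by rw [← hfix, hP.proj_mul])
      (by rw [← hfix, hP.mul_proj]), hfix, effectiveHamiltonian, ← trace_mul_kronecker,
      ← Matrix.mul_assoc, ← Matrix.mul_assoc, trace_mul_comm, ← Matrix.mul_assoc,
      ← Matrix.mul_assoc]
  rw [hB, hBk]

theorem hamSuper_block (hW : IsNSDecomposition (asymptoticSubspace Pinf) W ϱ)
    (hP : IsNonDecayingProjection Pinf P)
    (h : IsAsymptoticProjection (lindbladian H F κ) Pinf) (hH : H.IsHermitian)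
    (hκ : ∀ l, 0 < κ l) {A : Matrix n n ℂ} (hA : A.IsHermitian) (k : K)
    (B : Matrix (d k) (d k) ℂ) :
    hamSuper (P * traceDual Pinf A * P) (W k * (B ⊗ₖ ϱ k) * (W k)ᴴ) =
      W k * (hamSuper (effectiveHamiltonian (W k) (ϱ k) A) B ⊗ₖ ϱ k) * (W k)ᴴ := by
  have h1 := hW.traceDual_mul hP h hH hκ A k
  have h2 := congrArg conjTranspose h1
  rw [conjTranspose_mul, (hP.traceDual_compression_isHermitian h hH hA).eq, conjTranspose_mul,
    conjTranspose_kronecker, conjTranspose_one,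
    (effectiveHamiltonian_isHermitian (W k) (hW.posDef k).isHermitian hA).eq] at h2
  set X := effectiveHamiltonian (W k) (ϱ k) A
  have h3 : P * traceDual Pinf A * P * (W k * (B ⊗ₖ ϱ k) * (W k)ᴴ) =
      W k * ((X * B) ⊗ₖ ϱ k) * (W k)ᴴ := by
    rw [← Matrix.mul_assoc, ← Matrix.mul_assoc, h1, Matrix.mul_assoc (W k), ← mul_kronecker_mul,
      Matrix.one_mul]
  have h4 : W k * (B ⊗ₖ ϱ k) * (W k)ᴴ * (P * traceDual Pinf A * P) =
      W k * ((B * X) ⊗ₖ ϱ k) * (W k)ᴴ := by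
    rw [Matrix.mul_assoc, h2, ← Matrix.mul_assoc, Matrix.mul_assoc (W k), ← mul_kronecker_mul,
      Matrix.mul_one]
  have h5 : (X * B - B * X) ⊗ₖ ϱ k = (X * B) ⊗ₖ ϱ k - (B * X) ⊗ₖ ϱ k := by
    ext i j
    simp only [kroneckerMap_apply, Matrix.sub_apply, _root_.sub_mul]
  rw [hamSuper_apply, hamSuper_apply, h3, h4, smul_kronecker, h5, Matrix.mul_smul,
    Matrix.smul_mul, Matrix.mul_sub, Matrix.sub_mul]

end IsNSDecomposition

end Blocks

/-! ### The pseudoinverse on the non-decaying corners -/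

section CornerThree

variable {n ι : Type*} [Fintype n] [DecidableEq n] [Fintype ι]
variable {H : Matrix n n ℂ} {F : ι → Matrix n n ℂ} {κ : ι → ℝ} {Pinf : SuperOp n}
  {P : Matrix n n ℂ}

theorem cornerThree_mul_eq_iff (P : Matrix n n ℂ) (hP : P * P = P) (T : SuperOp n) :
    T * cornerThree P = cornerThree P * T * cornerThree P ↔
      ∀ X, (1 - P) * X * (1 - P) = 0 → (1 - P) * T X * (1 - P) = 0 := by
  have hQ : (1 - P) * (1 - P) = 1 - P := by
    rw [mul_sub, mul_one, sub_mul, one_mul, hP, sub_self, sub_zero]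
  have hR : T * cornerThree P = cornerThree P * T * cornerThree P ↔
      cornerLR P * (T * cornerThree P) = 0 := by
    conv_lhs => rhs; rw [cornerThree, sub_mul, one_mul, sub_mul, ← cornerThree]
    rw [eq_comm, sub_eq_self, mul_assoc]
  rw [hR]
  constructor
  · intro h X hX
    have h1 : cornerThree P X = X := by simp [cornerThree, cornerLR, hX]
    have := LinearMap.congr_fun h X
    rwa [Module.End.mul_apply, Module.End.mul_apply, h1, cornerLR, sandwich_apply] at this
  · intro h
    refine LinearMap.ext fun X => ?_
    rw [Module.End.mul_apply, Module.End.mul_apply, cornerLR, sandwich_apply, LinearMap.zero_apply]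
    apply h
    rw [cornerThree, LinearMap.sub_apply, Module.End.one_apply, cornerLR, sandwich_apply]
    generalize 1 - P = Q at hQ ⊢
    rw [mul_sub, sub_mul, ← mul_assoc, ← mul_assoc, hQ, mul_assoc _ Q Q, hQ, sub_self]

/-- If the range of `R` is invariant under `A` and under its Drazin inverse `D`, in the form
`A R = R A R` and `D R = R D R`, then the compression of `D` is the Drazin inverse of the
compression of `A`. -/
theorem IsDrazinInverse.compress {A D R : SuperOp n} (h : IsDrazinInverse A D)
    (hA : A * R = R * A * R) (hD : D * R = R * D * R) :
    IsDrazinInverse (R * A * R) (R * D * R) := by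
  have hAD : A * R * (D * R) = A * D * R := by
    rw [mul_assoc, ← mul_assoc R, ← hD, mul_assoc]
  have hDA : D * R * (A * R) = D * A * R := by
    rw [mul_assoc, ← mul_assoc R, ← hA, mul_assoc]
  rw [← hA, ← hD]
  refine ⟨by rw [hAD, hDA, h.comm], ?_, ?_⟩
  · rw [hAD, mul_assoc (A * D), ← mul_assoc R, ← hA, ← mul_assoc, h.inner]
  · rw [hDA, mul_assoc (D * A), ← mul_assoc R, ← hD, ← mul_assoc, h.outer]

end CornerThree

end LindbladResponse

/-! ### Response of the asymptotic subspace -/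

theorem mainTheorem7 {n ι : Type*} [Fintype n] [DecidableEq n] [Fintype ι]
    (H : Matrix n n ℂ) (hH : H.IsHermitian) (F : ι → Matrix n n ℂ)
    (κ : ι → ℝ) (hκ : ∀ l, 0 < κ l)
    (L : SuperOp n) (hL : L = lindbladian H F κ)
    (Pinf : SuperOp n) (hPinf : IsAsymptoticProjection L Pinf)
    (P : Matrix n n ℂ) (hP : IsNonDecayingProjection Pinf P)
    (PΨ : SuperOp n) (hPΨ : PΨ = minimalProjection Pinf P)
    (V : Matrix n n ℂ) (hV : V.IsHermitian) (f : ι → Matrix n n ℂ)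
    (O : SuperOp n) (hO : O = perturbation F κ V f) :
    -- no leak into the decaying corner, and clean leak
    (∀ ρ ∈ asymptoticSubspace Pinf, cornerLR P (O ρ) = 0) ∧
    (∀ ρ ∈ asymptoticSubspace Pinf, Pinf (O (Pinf ρ)) = PΨ (O (PΨ ρ))) ∧
    Pinf * O * Pinf = PΨ * O * Pinf ∧
    Pinf * O * Pinf * cornerUL P = PΨ * O * PΨ ∧
    -- the effect within `As(H)` is of Hamiltonian form
    (∃ G : Matrix n n ℂ, G.IsHermitian ∧ P * G * P = G ∧
      Pinf * O * Pinf = hamSuper G * Pinf) ∧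
    -- the effective Hamiltonian on each noiseless-subsystem block
    (∀ (K : Type*) [Fintype K] (d a : K → Type*)
      [∀ k, Fintype (d k)] [∀ k, DecidableEq (d k)] [∀ k, Fintype (a k)]
      [∀ k, DecidableEq (a k)]
      (W : ∀ k, Matrix n (d k × a k) ℂ) (ϱ : ∀ k, Matrix (a k) (a k) ℂ)
      (X : ∀ k, Matrix (d k) (d k) ℂ),
      IsNSDecomposition (asymptoticSubspace Pinf) W ϱ →
      (∀ k, X k = effectiveHamiltonian (W k) (ϱ k) (perturbationHamiltonian P F κ V f)) →
        (∀ k, (X k).IsHermitian) ∧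
        (∀ k (A : Matrix (d k) (d k) ℂ),
          Pinf (O (Pinf (W k * (A ⊗ₖ ϱ k) * (W k)ᴴ))) =
            W k * (hamSuper (X k) A ⊗ₖ ϱ k) * (W k)ᴴ) ∧
        (∀ ρ : Matrix n n ℂ, PΨ (O (PΨ ρ)) =
          ∑ k, W k * (hamSuper (X k) (traceAx ((W k)ᴴ * ρ * W k)) ⊗ₖ ϱ k) * (W k)ᴴ)) ∧
    -- the leakage term involves only `L` restricted to the three non-decaying corners
    L * cornerThree P = cornerThree P * L * cornerThree P ∧
    (∃ Linv LthreeInv : SuperOp n,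
      IsLeakageInverse L Pinf Linv ∧ IsDrazinInverse L Linv ∧ L * Linv = 1 - Pinf ∧
      IsDrazinInverse (cornerThree P * L * cornerThree P) LthreeInv ∧
      ∀ ρ ∈ asymptoticSubspace Pinf,
        Linv (O ρ) = Linv (cornerThree P (O ρ)) ∧ Linv (O ρ) = LthreeInv (O ρ)) := by
  subst hL hPΨ hO
  have hb := hP.isInvariantBlock hPinf hH hκ
  have hAs : ∀ X, Pinf X ∈ asymptoticSubspace Pinf := fun X => ⟨X, rfl⟩
  have hPl : ∀ {ρ}, ρ ∈ asymptoticSubspace Pinf → P * ρ = ρ := fun hρ => by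
    rw [← hPinf.apply_of_mem hρ, hP.proj_mul]
  have hPr : ∀ {ρ}, ρ ∈ asymptoticSubspace Pinf → ρ * P = ρ := fun hρ => by
    rw [← hPinf.apply_of_mem hρ, hP.mul_proj]
  have hleak : ∀ ρ ∈ asymptoticSubspace Pinf,
      (1 - P) * perturbation F κ V f ρ * (1 - P) = 0 := fun ρ hρ =>
    corner_perturbation_eq_zero hb (hPl hρ) (hPr hρ)
  have hul : ∀ ρ ∈ asymptoticSubspace Pinf, minimalProjection Pinf P (perturbation F κ V f ρ) =
      Pinf (perturbation F κ V f ρ) := fun ρ hρ => by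
    rw [minimalProjection, Module.End.mul_apply, cornerUL, sandwich_apply,
      ← hP.apply_eq_apply_compression hPinf hH hκ (hleak ρ hρ)]
  have hΨ : ∀ ρ, minimalProjection Pinf P ρ = Pinf (P * ρ * P) := fun ρ => by
    rw [minimalProjection, Module.End.mul_apply, cornerUL, sandwich_apply]
  have hΨmem : ∀ {ρ}, ρ ∈ asymptoticSubspace Pinf → minimalProjection Pinf P ρ = ρ := fun hρ => by
    rw [hΨ, hP.fixes _ hρ, hPinf.apply_of_mem hρ]
  have hHeff := perturbationHamiltonian_isHermitian (F := F) (κ := κ) (f := f) hP.isHermitian hV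
  have hlead : lindbladian H F κ * cornerThree P =
      cornerThree P * lindbladian H F κ * cornerThree P :=
    (cornerThree_mul_eq_iff P hP.idempotent _).2 fun X hX => corner_lindbladian_eq_zero hH hb hX
  refine ⟨fun ρ hρ => ?_, fun ρ hρ => ?_, LinearMap.ext fun ρ => ?_, LinearMap.ext fun ρ => ?_,
    ⟨_, hP.traceDual_compression_isHermitian hPinf hH hHeff, ?_, LinearMap.ext fun ρ => ?_⟩, ?_,
    hlead, ?_⟩
  · rw [cornerLR, sandwich_apply, hleak ρ hρ]
  · rw [hPinf.apply_of_mem hρ, hΨmem hρ, hul ρ hρ]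
  · simp only [Module.End.mul_apply]
    rw [hul _ (hAs ρ)]
  · simp only [Module.End.mul_apply, hΨ ρ, cornerUL, sandwich_apply]
    rw [hul _ (hAs _)]
  · simp only [mul_assoc, hP.idempotent]
    simp only [← mul_assoc, hP.idempotent]
  · simp only [Module.End.mul_apply]
    exact hP.apply_perturbation hPinf hH hκ V f (hAs ρ)
  · intro K _ d a _ _ _ _ W ϱ X hW hX
    obtain rfl : X = fun k =>
        effectiveHamiltonian (W k) (ϱ k) (perturbationHamiltonian P F κ V f) := funext hX
    have hblock := hW.hamSuper_block hP hPinf hH hκ hHeff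
    refine ⟨fun k => effectiveHamiltonian_isHermitian _ (hW.posDef k).isHermitian hHeff,
      fun k A => ?_, fun ρ => ?_⟩
    · rw [hPinf.apply_of_mem (hW.block_mem k A),
        hP.apply_perturbation hPinf hH hκ V f (hW.block_mem k A), hblock]
    · rw [hΨ ρ, hul _ (hAs _), hP.apply_perturbation hPinf hH hκ V f (hAs _),
        hW.apply_compression hP hPinf hH hκ, map_sum]
      exact Finset.sum_congr rfl fun k _ => hblock k _
  · have hD3 : drazinInverse (lindbladian H F κ) Pinf * cornerThree P =
        cornerThree P * drazinInverse (lindbladian H F κ) Pinf * cornerThree P :=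
      (cornerThree_mul_eq_iff P hP.idempotent _).2 fun X hX => by
        have := hPinf.drazinInverse_mem (N := cornerLR P) (X := X)
          (fun X hX => by
            rw [cornerLR, sandwich_apply] at hX ⊢
            exact corner_lindbladian_eq_zero hH hb hX)
          (fun X => by rw [cornerLR, sandwich_apply, hP.corner_apply])
          (by rw [cornerLR, sandwich_apply, hX])
        rwa [cornerLR, sandwich_apply] at this
    have hfix : ∀ ρ ∈ asymptoticSubspace Pinf,
        cornerThree P (perturbation F κ V f ρ) = perturbation F κ V f ρ := fun ρ hρ => by
      rw [cornerThree, LinearMap.sub_apply, Module.End.one_apply, cornerLR, sandwich_apply,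
        hleak ρ hρ, sub_zero]
    refine ⟨drazinInverse (lindbladian H F κ) Pinf, _, hPinf.isLeakageInverse,
      hPinf.isDrazinInverse, hPinf.map_mul_drazinInverse,
      hPinf.isDrazinInverse.compress hlead hD3, fun ρ hρ => ⟨?_, ?_⟩⟩
    · rw [hfix ρ hρ]
    · rw [← hD3, Module.End.mul_apply, hfix ρ hρ]
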